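/- For $m\in\mathbb N$ let $d_m(\sigma,\tau)=\frac1m|\{i : \sigma(i)\neq\tau(i)\}|$ be the normalized Hamming metric on the symmetric group $\mathrm{Sym}(m)$. For a sequence $(k_n)_n$ of natural numbers, let $\mathrm{Sym}[(k_n)_n]$ be the quotient of the group $\prod_n \mathrm{Sym}(k_n)$ by the normal subgroup $\{(a_n)_n : \limsup_n d_{k_n}(a_n,1)=0\}$, with the metric $d(a,b)=\limsup_n d_{k_n}(a_n,b_n)$. Let $\mathcal P(\mathbb N)/\mathrm{Fin}$ be the Boolean algebra of subsets of $\mathbb N$ modulo finite sets. For (the class of) an infinite set $S\subseteq\mathbb N$ let $d^S(a,b)=\limsup_{n\in S}d_{k_n}(a_n,b_n)$ be the corresponding pseudometric on $\mathrm{Sym}[(k_n)_n]$; it depends only on the class of $S$ in $\mathcal P(\mathbb N)/\mathrm{Fin}$. Let $(k_n)_n$ and $(l_n)_n$ be sequences of natural numbers with $\lim_n k_n=\lim_n l_n=\infty$, and let $\varphi:\mathrm{Sym}[(k_n)_n]\to\mathrm{Sym}[(l_n)_n]$ be an isomorphism of (abstract) groups. Then (in $\mathsf{ZFC}$): 1.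 $\varphi$ is isometric: $d(a,b)=d(\varphi(a),\varphi(b))$ for all $a,b\in\mathrm{Sym}[(k_n)_n]$. 2. $\varphi$ induces an automorphism of $\mathcal P(\mathbb N)/\mathrm{Fin}$: there is exactly one automorphism $\theta$ of the Boolean algebra $\mathcal P(\mathbb N)/\mathrm{Fin}$ such that, for every infinite $S$ and all $a,b\in\mathrm{Sym}[(k_n)_n]$, $d^S(a,b)=0$ if and only if $d^{\theta(S)}(\varphi(a),\varphi(b))=0$. 3. For this $\theta$, every infinite $S\in\mathcal P(\mathbb N)/\mathrm{Fin}$ and all $a,b\in\mathrm{Sym}[(k_n)_n]$, one has $d^S(a,b)=d^{\theta(S)}(\varphi(a),\varphi(b))$. -/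

import Mathlib

open Filter Topology

namespace SymReduced

/-- The normalized Hamming metric on `Sym(m)`: the proportion of points on which two permutations
differ. -/
noncomputable def hamming {m : ℕ} (σ τ : Equiv.Perm (Fin m)) : ℝ :=
  (hammingDist (⇑σ) (⇑τ) : ℝ) / (m : ℝ)

theorem hamming_nonneg {m : ℕ} (σ τ : Equiv.Perm (Fin m)) : 0 ≤ hamming σ τ := by
  unfold hamming; positivity

theorem hamming_le_one {m : ℕ} (σ τ : Equiv.Perm (Fin m)) : hamming σ τ ≤ 1 := by
  unfold hamming
  apply div_le_one_of_le₀ _ (by positivity)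
  have h := hammingDist_le_card_fintype (x := (⇑σ)) (y := (⇑τ))
  rw [Fintype.card_fin] at h
  exact_mod_cast h

theorem hamming_self {m : ℕ} (σ : Equiv.Perm (Fin m)) : hamming σ σ = 0 := by
  simp [hamming]

theorem hamming_comm {m : ℕ} (σ τ : Equiv.Perm (Fin m)) : hamming σ τ = hamming τ σ := by
  simp [hamming, hammingDist_comm]

theorem hamming_triangle {m : ℕ} (σ τ ρ : Equiv.Perm (Fin m)) :
    hamming σ ρ ≤ hamming σ τ + hamming τ ρ := by
  unfold hamming
  rw [← add_div]
  gcongr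
  exact_mod_cast hammingDist_triangle (⇑σ) (⇑τ) (⇑ρ)

theorem hamming_mul_left {m : ℕ} (ρ σ τ : Equiv.Perm (Fin m)) :
    hamming (ρ * σ) (ρ * τ) = hamming σ τ := by
  simp [hamming, hammingDist]

theorem hamming_mul_right {m : ℕ} (ρ σ τ : Equiv.Perm (Fin m)) :
    hamming (σ * ρ) (τ * ρ) = hamming σ τ := by
  unfold hamming hammingDist
  congr 2
  refine Finset.card_bij (fun i _ => ρ i) ?_ ?_ ?_
  · intro i hi
    simp only [Finset.mem_filter_univ] at hi ⊢
    exact hi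
  · intro i _ j _ h; exact ρ.injective h
  · intro j hj
    refine ⟨ρ.symm j, ?_, by simp⟩
    simp only [Finset.mem_filter_univ] at hj ⊢
    simpa using hj

/-- `limsup_{n ∈ S} d_n(a_n, b_n)` for sequences of permutations, where `n` runs to infinity
through `S`. -/
noncomputable def seqDist {k : ℕ → ℕ} (S : Set ℕ) (a b : ∀ n, Equiv.Perm (Fin (k n))) : ℝ :=
  limsup (fun n => hamming (a n) (b n)) (cofinite ⊓ 𝓟 S)

theorem limsup_le_of_diff {f : Filter ℕ} {u v : ℕ → ℝ}
    (hu : ∀ n, 0 ≤ u n) (hv1 : ∀ n, v n ≤ 1)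
    (h : Tendsto (fun n => u n - v n) f (𝓝 0)) : limsup u f ≤ limsup v f := by
  rcases f.eq_or_neBot with rfl | hf
  · simp [limsup, limsSup]
  · refine le_of_forall_pos_le_add fun ε hε => ?_
    have h1 : ∀ᶠ n in f, u n - v n < ε / 2 := h.eventually (gt_mem_nhds (by linarith))
    have h2 : ∀ᶠ n in f, v n < limsup v f + ε / 2 :=
      eventually_lt_of_limsup_lt (by linarith)
        (isBoundedUnder_of ⟨1, hv1⟩)
    refine limsup_le_of_le (isCoboundedUnder_le_of_le f hu) ?_
    filter_upwards [h1, h2] with n a b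
    linarith

theorem limsup_eq_zero_iff {k : ℕ → ℕ} (a : ∀ n, Equiv.Perm (Fin (k n))) :
    limsup (fun n => hamming (a n) 1) atTop = 0 ↔
      Tendsto (fun n => hamming (a n) 1) atTop (𝓝 0) := by
  refine ⟨fun h => ?_, fun h => h.limsup_eq⟩
  refine tendsto_order.2 ⟨fun x hx => Eventually.of_forall fun n =>
    hx.trans_le (hamming_nonneg _ _), fun x hx => ?_⟩
  exact eventually_lt_of_limsup_lt (by rw [h]; exact hx)
    (isBoundedUnder_of ⟨1, fun n => hamming_le_one _ _⟩)

/-- The normal subgroup `N((k_n)_n)` of sequences `(a_n)_n` with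
`limsup_n d_n(a_n, 1) = 0`. -/
def nullSubgroup (k : ℕ → ℕ) : Subgroup (∀ n, Equiv.Perm (Fin (k n))) where
  carrier := {a | limsup (fun n => hamming (a n) 1) atTop = 0}
  one_mem' := by
    simp [hamming_self]
  mul_mem' := by
    intro a b ha hb
    simp only [Set.mem_ofPred_eq, limsup_eq_zero_iff] at ha hb ⊢
    have hab := ha.add hb
    rw [add_zero] at hab
    refine squeeze_zero (fun n => hamming_nonneg _ _) (fun n => ?_) hab
    have h1 := hamming_triangle ((a * b) n) (a n) 1
    have h2 := hamming_mul_left (a n) (b n) 1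
    rw [mul_one] at h2
    rw [Pi.mul_apply] at h1 ⊢
    linarith
  inv_mem' := by
    intro a ha
    simp only [Set.mem_ofPred_eq] at ha ⊢
    rw [← ha]
    congr 1
    funext n
    have h := hamming_mul_left (a n) (a⁻¹ n) 1
    rw [Pi.inv_apply, mul_inv_cancel, mul_one, hamming_comm] at h
    exact h.symm

instance nullSubgroup_normal (k : ℕ → ℕ) : (nullSubgroup k).Normal where
  conj_mem := by
    intro a ha g
    change limsup (fun n => hamming (a n) 1) atTop = 0 at ha
    change limsup (fun n => hamming (g n * a n * (g n)⁻¹) 1) atTop = 0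
    rw [← ha]
    congr 1
    funext n
    rw [← hamming_mul_right (g n) (g n * a n * (g n)⁻¹) 1, inv_mul_cancel_right, one_mul]
    simpa using hamming_mul_left (g n) (a n) 1

/-- The metric reduced product `Sym[(k_n)_n]`, as a group. -/
abbrev SymRed (k : ℕ → ℕ) : Type :=
  (∀ n, Equiv.Perm (Fin (k n))) ⧸ nullSubgroup k

/-- `𝒫(ℕ)/Fin`: subsets of `ℕ` (viewed as predicates) modulo equality at all but finitely many
points, ordered by inclusion modulo finite sets. Its least element is the class of the finite
sets, so the classes of infinite sets are the elements different from `⊥`. -/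
abbrev PFin : Type := Germ (cofinite : Filter ℕ) Prop

theorem seqDist_le {k : ℕ → ℕ} {S T : Set ℕ} {a b a' b' : ∀ n, Equiv.Perm (Fin (k n))}
    (hS : (fun n => n ∈ S) =ᶠ[cofinite] (fun n => n ∈ T))
    (ha : a⁻¹ * a' ∈ nullSubgroup k) (hb : b⁻¹ * b' ∈ nullSubgroup k) :
    seqDist S a b ≤ seqDist T a' b' := by
  have hST : (cofinite : Filter ℕ) ⊓ 𝓟 S = cofinite ⊓ 𝓟 T := by
    ext V
    simp only [mem_inf_principal]
    refine eventually_congr (p := fun n => n ∈ S → n ∈ V) (q := fun n => n ∈ T → n ∈ V) ?_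
    filter_upwards [hS] with n hn
    rw [hn]
  unfold seqDist
  rw [hST]
  have key : ∀ c c' : ∀ n, Equiv.Perm (Fin (k n)), c⁻¹ * c' ∈ nullSubgroup k →
      Tendsto (fun n => hamming (c n) (c' n)) cofinite (𝓝 0) := by
    intro c c' h
    have h' := (limsup_eq_zero_iff _).1 h
    rw [Nat.cofinite_eq_atTop]
    refine h'.congr fun n => ?_
    rw [← hamming_mul_left (c n), hamming_comm]
    simp
  have hab := ((key a a' ha).add (key b b' hb)).mono_left
    (inf_le_left : (cofinite : Filter ℕ) ⊓ 𝓟 T ≤ cofinite)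
  rw [add_zero] at hab
  refine limsup_le_of_diff (fun n => hamming_nonneg _ _) (fun n => hamming_le_one _ _) ?_
  refine squeeze_zero_norm (fun n => ?_) hab
  have h1 := hamming_triangle (a n) (a' n) (b n)
  have h2 := hamming_triangle (a' n) (b' n) (b n)
  have h3 := hamming_triangle (a' n) (a n) (b' n)
  have h4 := hamming_triangle (a n) (b n) (b' n)
  have h5 := hamming_comm (a n) (a' n)
  have h6 := hamming_comm (b n) (b' n)
  rw [Real.norm_eq_abs, abs_le]
  constructor <;> linarith

theorem seqDist_congr {k : ℕ → ℕ} {S T : Set ℕ} {a b a' b' : ∀ n, Equiv.Perm (Fin (k n))}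
    (hS : (fun n => n ∈ S) =ᶠ[cofinite] (fun n => n ∈ T))
    (ha : a⁻¹ * a' ∈ nullSubgroup k) (hb : b⁻¹ * b' ∈ nullSubgroup k) :
    seqDist S a b = seqDist T a' b' := by
  refine le_antisymm (seqDist_le hS ha hb) (seqDist_le hS.symm ?_ ?_)
  · simpa using inv_mem ha
  · simpa using inv_mem hb

/-- The pseudometric `d^S(a, b) = limsup_{n ∈ S} d_n(a_n, b_n)` on `Sym[(k_n)_n]`, for
`S ∈ 𝒫(ℕ)/Fin`. -/
noncomputable def symDist {k : ℕ → ℕ} (S : PFin) (x y : SymRed k) : ℝ :=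
  Quotient.liftOn S
    (fun p => Quotient.liftOn₂ x y (fun a b => seqDist {n | p n} a b)
      (fun _ _ _ _ ha hb => seqDist_congr EventuallyEq.rfl
        (QuotientGroup.leftRel_apply.1 ha) (QuotientGroup.leftRel_apply.1 hb)))
    (fun p q h => by
      induction x, y using Quotient.inductionOn₂
      exact seqDist_congr h (by simp) (by simp))

theorem symDist_mk {k : ℕ → ℕ} (S : Set ℕ) (a b : ∀ n, Equiv.Perm (Fin (k n))) :
    symDist (((fun n => n ∈ S) : ℕ → Prop) : PFin) (a : SymRed k) (b : SymRed k) =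
      limsup (fun n => hamming (a n) (b n)) (cofinite ⊓ 𝓟 S) := rfl

/-- The metric `d(a, b) = limsup_n d_n(a_n, b_n)` of `Sym[(k_n)_n]`. -/
noncomputable def symMetric {k : ℕ → ℕ} (x y : SymRed k) : ℝ :=
  Quotient.liftOn₂ x y (fun a b => limsup (fun n => hamming (a n) (b n)) atTop)
    (fun a b a' b' ha hb => by
      have h := seqDist_congr (S := Set.univ) EventuallyEq.rfl
        (QuotientGroup.leftRel_apply.1 ha) (QuotientGroup.leftRel_apply.1 hb)
      simpa [seqDist, Nat.cofinite_eq_atTop] using h)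

/-- The automorphism `θ` of the Boolean algebra `𝒫(ℕ)/Fin` is induced by the isomorphism `φ`:
`a =_S b ↔ φ(a) =_{θ(S)} φ(b)` for all `a`, `b` and all infinite `S`, where `a =_S b` means
`d^S(a, b) = 0`. (Automorphisms of a Boolean algebra are the same as its order automorphisms.) -/
def Induces {k l : ℕ → ℕ} (φ : SymRed k ≃* SymRed l) (θ : PFin ≃o PFin) : Prop :=
  ∀ S : PFin, S ≠ ⊥ → ∀ a b : SymRed k,
    symDist S a b = 0 ↔ symDist (θ S) (φ a) (φ b) = 0

end SymReduced

/-!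
Write `|x|_S = symDist S x 1` for the length of `x` along `S`. The proof recovers from the group
structure first the sets along which an element is null, then the lengths of involutions, and
finally all lengths.

*The automorphism.* Call `x` orthogonal to `y` if `x` commutes with all conjugates of `y`. For an
involution `y` this says that the minimum of the two lengths tends to `0` (`orth_iff_tendsto`).
Hence the elements that are null along `S` are those orthogonal to an involution which has almost
full support on `S` and is trivial off `S`. Such involutions belong to complemented pairs of
orthogonal involutions, that is, pairs to which only `1` is orthogonal, and conversely every
complemented pair cuts out some `S` (`exists_orth_iff`). This is a group-theoretic condition, so an
isomorphism carries the subgroups "null along `S`" to each other; they determine `S` together with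
its order (`le_iff_forall_symDist_eq_zero`), which gives existence and uniqueness of `θ`.

*Involutions.* In a finite symmetric group an involution `π` is, up to a bounded number of points, a
product of `q` conjugates of the involution `σ` as soon as `|π| ≤ q |σ|`, for even `q ≥ 4`
(`exists_mem_conjugatesOf_pow_near`), whereas a product of `q` conjugates of `σ` has length at most
`q |σ|`. Take `σ` of length `1 / (q + 1)`. Along no infinite set is every involution a product of
`q` conjugates of `σ`, so the same is true of `φ σ`, whose length is therefore at most `1 / q`.
Every `π` is a product of about `q |π|` conjugates of `σ`, so the length of `φ π` is at most
`|π| + O(1 / q)`. Letting `q` tend to infinity, and exchanging the roles of `φ` and its inverse,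
`φ` preserves the lengths of involutions.

*Arbitrary elements.* Two involutions have almost disjoint supports if and only if the length of
their product is the sum of their lengths along all sets (`LengthAdditive`). For commuting
involutions the product is again an involution, so this relation is preserved by `φ`. An element
`x` is almost supported on the support of an involution `r` if and only if it commutes with all
involutions almost disjoint from `r`; since there is such an `r` having the length of `x`, the
lengths of all elements are preserved.
-/

namespace SymReduced

/-! ### Involutions of a finite set -/

section Finite

open scoped Pointwise

variable {α : Type*} [DecidableEq α] [Fintype α]

/-- A set of points moved by `a` contains a third of itself that is disjoint from its image: a maximal
such subset, its image and its preimage cover the set. -/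
theorem exists_subset_disjoint_image (a : Equiv.Perm α) (B : Finset α)
    (hB : ∀ x ∈ B, a x ≠ x) :
    ∃ B' ⊆ B, B.card ≤ 3 * B'.card ∧ ∀ x ∈ B', a x ∉ B' := by
  obtain ⟨M, hM⟩ := (B.powerset.filter fun C => ∀ x ∈ C, a x ∉ C).exists_maximal
    ⟨∅, by simp⟩
  have hM1 := hM.prop
  simp only [Finset.mem_filter, Finset.mem_powerset] at hM1
  refine ⟨M, hM1.1, ?_, hM1.2⟩
  have hcover : B ⊆ M ∪ (M.map a.toEmbedding ∪ M.map a.symm.toEmbedding) := by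
    intro x hx
    by_contra hcon
    simp only [Finset.mem_union, Finset.mem_map_equiv, Equiv.symm_symm, not_or] at hcon
    obtain ⟨h1, h2, h3⟩ := hcon
    have : insert x M ∈ B.powerset.filter fun C => ∀ x ∈ C, a x ∉ C := by
      simp only [Finset.mem_filter, Finset.mem_powerset]
      refine ⟨Finset.insert_subset hx hM1.1, ?_⟩
      intro y hy hay
      rw [Finset.mem_insert] at hy hay
      rcases hy with rfl | hy <;> rcases hay with hay | hay
      · exact hB _ hx hay
      · exact h3 hay
      · exact h2 (by rw [← hay]; simpa using hy)
      · exact hM1.2 y hy hay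
    exact h1 (hM.le_of_ge this (Finset.subset_insert x M) (Finset.mem_insert_self x M))
  have h1 := Finset.card_le_card hcover
  have h2 := Finset.card_union_le M (M.map a.toEmbedding ∪ M.map a.symm.toEmbedding)
  have h3 := Finset.card_union_le (M.map a.toEmbedding) (M.map a.symm.toEmbedding)
  rw [Finset.card_map, Finset.card_map] at h3
  omega

theorem cycleType_of_mul_self {σ : Equiv.Perm α} (h : σ * σ = 1) :
    σ.cycleType = Multiset.replicate σ.cycleType.card 2 := by
  refine Multiset.eq_replicate_card.2 fun b hb => ?_
  have h1 := Equiv.Perm.two_le_of_mem_cycleType hb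
  have h2 := (Equiv.Perm.dvd_of_mem_cycleType hb).trans
    (orderOf_dvd_of_pow_eq_one (by rw [pow_two, h]))
  exact le_antisymm (Nat.le_of_dvd (by norm_num) h2) h1

theorem card_support_of_mul_self {σ : Equiv.Perm α} (h : σ * σ = 1) :
    σ.support.card = 2 * σ.cycleType.card := by
  rw [← Equiv.Perm.sum_cycleType, cycleType_of_mul_self h]
  simp [mul_comm]

theorem isConj_of_card_support_eq {σ τ : Equiv.Perm α} (hσ : σ * σ = 1) (hτ : τ * τ = 1)
    (h : σ.support.card = τ.support.card) : IsConj σ τ := by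
  rw [Equiv.Perm.isConj_iff_cycleType_eq, cycleType_of_mul_self hσ, cycleType_of_mul_self hτ]
  rw [card_support_of_mul_self hσ, card_support_of_mul_self hτ] at h
  rw [show σ.cycleType.card = τ.cycleType.card by omega]

theorem exists_involution_support_eq (B : Finset α) (hB : Even B.card) :
    ∃ τ : Equiv.Perm α, τ * τ = 1 ∧ τ.support = B := by
  obtain ⟨n, hn⟩ := hB
  induction n generalizing B with
  | zero => exact ⟨1, by simp, by simpa using (Finset.card_eq_zero.1 hn).symm⟩
  | succ n ih =>
    obtain ⟨x, hx⟩ := Finset.card_pos.1 (by omega : 0 < B.card)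
    have h1 := Finset.card_erase_of_mem hx
    obtain ⟨y, hy⟩ := Finset.card_pos.1 (by omega : 0 < (B.erase x).card)
    have h2 := Finset.card_erase_of_mem hy
    obtain ⟨τ, hτ, hs⟩ := ih ((B.erase x).erase y) (by omega)
    have hxy : x ≠ y := (Finset.ne_of_mem_erase hy).symm
    have hd : Equiv.Perm.Disjoint (Equiv.swap x y) τ := by
      rw [Equiv.Perm.disjoint_iff_disjoint_support, hs, Equiv.Perm.support_swap hxy]
      simp [Finset.disjoint_left]
    refine ⟨Equiv.swap x y * τ, ?_, ?_⟩
    · rw [mul_assoc, ← mul_assoc τ, ← hd.commute.eq, mul_assoc, hτ]; simp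
    · rw [hd.support_mul, hs, Equiv.Perm.support_swap hxy]
      ext z
      simp only [Finset.mem_union, Finset.mem_insert, Finset.mem_singleton, Finset.mem_erase]
      have := Finset.mem_of_mem_erase hy
      grind

theorem exists_involution_support_subset (B : Finset α) :
    ∃ τ : Equiv.Perm α, τ * τ = 1 ∧ τ.support ⊆ B ∧ B.card ≤ τ.support.card + 1 := by
  obtain ⟨C, hC, hc⟩ := Finset.exists_subset_card_eq (s := B) (n := 2 * (B.card / 2)) (by omega)
  obtain ⟨τ, h1, h2⟩ := exists_involution_support_eq C (by rw [hc]; simp)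
  exact ⟨τ, h1, h2 ▸ hC, by rw [h2]; omega⟩

theorem mul_self_mul_of_commute {G : Type*} [Group G] {a b : G} (hab : Commute a b)
    (ha : a * a = 1) (hb : b * b = 1) : a * b * (a * b) = 1 := by
  rw [mul_assoc, ← mul_assoc b, ← hab.eq, mul_assoc, hb, mul_one, ha]

/-- A set of even size `2 s` disjoint from a given set carries an involution. -/
theorem exists_involution_disjoint (A : Finset α) (s : ℕ)
    (h : A.card + 2 * s ≤ Fintype.card α) :
    ∃ τ : Equiv.Perm α, τ * τ = 1 ∧ τ.support.card = 2 * s ∧ Disjoint A τ.support := by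
  obtain ⟨C, hC, hc⟩ := Finset.exists_subset_card_eq (s := Aᶜ) (n := 2 * s)
    (by rw [Finset.card_compl]; omega)
  obtain ⟨τ, h1, h2⟩ := exists_involution_support_eq C (by rw [hc]; simp)
  refine ⟨τ, h1, by rw [h2, hc], ?_⟩
  rw [h2]
  exact Finset.disjoint_of_subset_right hC disjoint_compl_right

/-- An involution splits into two involutions with prescribed sizes of the supports. -/
theorem exists_mul_of_card_support {π : Equiv.Perm α} (hπ : π * π = 1) (s t : ℕ)
    (h : π.support.card = 2 * (s + t)) :
    ∃ p q : Equiv.Perm α, p * p = 1 ∧ q * q = 1 ∧ p.support.card = 2 * s ∧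
      q.support.card = 2 * t ∧ π = p * q := by
  have hle := Finset.card_le_univ π.support
  obtain ⟨p, hp, hps, -⟩ := exists_involution_disjoint (∅ : Finset α) s (by simp; omega)
  obtain ⟨q, hq, hqs, hd⟩ := exists_involution_disjoint p.support t (by omega)
  have hd' := Equiv.Perm.disjoint_iff_disjoint_support.2 hd
  obtain ⟨g, hg⟩ := isConj_iff.1 (isConj_of_card_support_eq
    (mul_self_mul_of_commute hd'.commute hp hq) hπ (by rw [hd'.card_support_mul]; omega))
  refine ⟨g * p * g⁻¹, g * q * g⁻¹, ?_, ?_, ?_, ?_, ?_⟩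
  · rw [conj_mul, hp]; simp
  · rw [conj_mul, hq]; simp
  · rw [Equiv.Perm.card_support_conj, hps]
  · rw [Equiv.Perm.card_support_conj, hqs]
  · rw [conj_mul, hg]

/-- Klein's four-group acting freely on the last two coordinates. -/
theorem exists_klein_model (γ : Type*) :
    ∃ s t : Equiv.Perm (γ × Bool × Bool), s * s = 1 ∧ t * t = 1 ∧ Commute s t ∧
      (∀ x, s x ≠ x) ∧ (∀ x, t x ≠ x) ∧ ∀ x, (s * t) x ≠ x := by
  have hs : Function.Involutive fun x : γ × Bool × Bool => (x.1, !x.2.1, x.2.2) := by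
    intro x; simp
  have ht : Function.Involutive fun x : γ × Bool × Bool => (x.1, x.2.1, !x.2.2) := by
    intro x; simp
  refine ⟨hs.toPerm, ht.toPerm, Equiv.ext hs, Equiv.ext ht, Equiv.ext fun x => rfl, ?_, ?_, ?_⟩ <;>
  · rintro ⟨i, b, b'⟩ h
    cases b <;> cases b' <;> cases h

/-- Every set of size divisible by four carries a free action of Klein's four-group. -/
theorem exists_klein (Z : Finset α) (c : ℕ) (h : Z.card = 4 * c) :
    ∃ y z : Equiv.Perm α, y * y = 1 ∧ z * z = 1 ∧ Commute y z ∧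
      y.support = Z ∧ z.support = Z ∧ (y * z).support = Z := by
  obtain ⟨s, t, hs1, ht1, hst, hs, ht, hstx⟩ := exists_klein_model (Fin c)
  have e : (Fin c × Bool × Bool) ≃ Z := Fintype.equivOfCardEq (by simp; omega)
  obtain ⟨f, hf⟩ : ∃ f : (Fin c × Bool × Bool) ↪ α, ∀ x, x ∈ Set.range f ↔ x ∈ Z := by
    refine ⟨e.toEmbedding.trans (Function.Embedding.subtype _), fun x => ⟨?_, ?_⟩⟩
    · rintro ⟨y, rfl⟩; exact (e y).2
    · exact fun hx => ⟨e.symm ⟨x, hx⟩, by simp⟩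
  have hsupp : ∀ r : Equiv.Perm (Fin c × Bool × Bool), (∀ x, r x ≠ x) →
      (Equiv.Perm.viaEmbeddingHom f r).support = Z := by
    intro r hr
    ext x
    rw [Equiv.Perm.mem_support, ← hf]
    constructor
    · intro hx
      by_contra hcon
      exact hx (Equiv.Perm.viaEmbedding_apply_of_notMem r f x hcon)
    · rintro ⟨y, rfl⟩
      change Equiv.Perm.viaEmbedding r f (f y) ≠ f y
      rw [Equiv.Perm.viaEmbedding_apply]
      exact f.injective.ne (hr y)
  refine ⟨Equiv.Perm.viaEmbeddingHom f s, Equiv.Perm.viaEmbeddingHom f t, ?_, ?_, hst.map _,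
    hsupp s hs, hsupp t ht, ?_⟩
  · rw [← map_mul, hs1, map_one]
  · rw [← map_mul, ht1, map_one]
  · rw [← map_mul, hsupp _ hstx]

/-- An involution whose support has `4 c` points is a product of two conjugates of any involution `σ`
with at least `c` transpositions. If there is room, the conjugates share only the transpositions
of `σ` in excess of `c`, placed outside the support of `π`; otherwise `σ` is so large that they can
be taken to generate Klein four-groups on the support of `π`. -/
theorem exists_conj_mul_conj {σ π : Equiv.Perm α} (hσ : σ * σ = 1) (hπ : π * π = 1) {u c : ℕ}
    (hu : σ.support.card = 2 * u) (hc : π.support.card = 4 * c) (hcu : c ≤ u)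
    (hcm : 8 * c ≤ Fintype.card α) :
    π ∈ conjugatesOf σ * conjugatesOf σ := by
  have hle := Finset.card_le_univ σ.support
  -- The support size determines the conjugacy class, so any commuting pair of the right sizes does.
  suffices H : ∃ y z : Equiv.Perm α, y * y = 1 ∧ z * z = 1 ∧ Commute y z ∧
      y.support.card = 2 * u ∧ z.support.card = 2 * u ∧ (y * z).support.card = 4 * c by
    obtain ⟨y, z, hy, hz, hyz, h1, h2, h3⟩ := H
    obtain ⟨g, hg⟩ := isConj_iff.1 (isConj_of_card_support_eq
      (mul_self_mul_of_commute hyz hy hz) hπ (by omega))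
    refine Set.mem_mul.2 ⟨g * y * g⁻¹, ?_, g * z * g⁻¹, ?_, by rw [conj_mul, hg]⟩
    · exact (isConj_of_card_support_eq hσ hy (by omega)).trans (isConj_iff.2 ⟨g, rfl⟩)
    · exact (isConj_of_card_support_eq hσ hz (by omega)).trans (isConj_iff.2 ⟨g, rfl⟩)
  by_cases h : 2 * c + 2 * u ≤ Fintype.card α
  · obtain ⟨r, hr, hrs, -⟩ := exists_involution_disjoint (∅ : Finset α) (u - c) (by simp; omega)
    obtain ⟨p, hp, hps, hd⟩ := exists_involution_disjoint r.support c (by omega)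
    have hrp := Equiv.Perm.disjoint_iff_disjoint_support.2 hd
    obtain ⟨q, hq, hqs, hd2⟩ := exists_involution_disjoint (r * p).support c
      (by rw [hrp.card_support_mul]; omega)
    rw [hrp.support_mul, Finset.disjoint_union_left] at hd2
    have hrq := Equiv.Perm.disjoint_iff_disjoint_support.2 hd2.1
    have hpq := Equiv.Perm.disjoint_iff_disjoint_support.2 hd2.2
    refine ⟨r * p, r * q, mul_self_mul_of_commute hrp.commute hr hp,
      mul_self_mul_of_commute hrq.commute hr hq, ?_, ?_, ?_, ?_⟩
    · exact ((Commute.refl r).mul_right hrq.commute).mul_left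
        (hrp.symm.commute.mul_right hpq.commute)
    · rw [hrp.card_support_mul]; omega
    · rw [hrq.card_support_mul]; omega
    · rw [hrp.commute.eq, mul_assoc, ← mul_assoc r, hr, one_mul, hpq.card_support_mul]; omega
  · obtain ⟨Z, -, hZ⟩ := Finset.exists_subset_card_eq (s := (Finset.univ : Finset α))
      (n := 4 * c) (by rw [Finset.card_univ]; omega)
    obtain ⟨y, z, hy, hz, hyz, hys, hzs, hyzs⟩ := exists_klein Z c hZ
    obtain ⟨r, hr, hrs, hd⟩ := exists_involution_disjoint Z (u - 2 * c) (by omega)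
    have hyr := Equiv.Perm.disjoint_iff_disjoint_support.2 (hys ▸ hd)
    have hzr := Equiv.Perm.disjoint_iff_disjoint_support.2 (hzs ▸ hd)
    refine ⟨y * r, r * z, mul_self_mul_of_commute hyr.commute hy hr,
      mul_self_mul_of_commute hzr.symm.commute hr hz, ?_, ?_, ?_, ?_⟩
    · exact (hyr.commute.mul_right hyz).mul_left
        ((Commute.refl r).mul_right hzr.symm.commute)
    · rw [hyr.card_support_mul, hys]; omega
    · rw [hzr.symm.card_support_mul, hzs]; omega
    · rw [mul_assoc, ← mul_assoc r, hr, one_mul, hyzs, hZ]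

/-- Such an involution splits into `j` pieces with `2 c` transpositions each, and every piece is a
product of two conjugates of `σ`. -/
theorem mem_conjugatesOf_pow {σ π : Equiv.Perm α} (hσ : σ * σ = 1) (hπ : π * π = 1) {u c j : ℕ}
    (hu : σ.support.card = 2 * u) (hc : π.support.card = 4 * c * j) (hcu : c ≤ u)
    (hcm : 8 * c ≤ Fintype.card α) :
    π ∈ conjugatesOf σ ^ (2 * j) := by
  induction j generalizing π with
  | zero => simpa using hc
  | succ j ih =>
    obtain ⟨p, q, hp, hq, hps, hqs, rfl⟩ := exists_mul_of_card_support hπ (2 * c) (2 * c * j)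
      (by rw [hc]; ring)
    rw [show 2 * (j + 1) = 2 + 2 * j by ring, pow_add, pow_two]
    exact Set.mul_mem_mul (exists_conj_mul_conj hσ hp hu (by omega) hcu hcm)
      (ih hq (by rw [hqs]; ring))

/-- Two permutations commute except at the points of the intersection of the supports and of its
preimages. -/
theorem hammingDist_mul_comm_le (a b : Equiv.Perm α) :
    hammingDist ⇑(a * b) ⇑(b * a) ≤
      3 * (a.support ∩ b.support).card := by
  set I := a.support ∩ b.support with hI
  have hcover : (Finset.univ.filter fun x => (a * b) x ≠ (b * a) x) ⊆
      I ∪ (I.map a.symm.toEmbedding ∪ I.map b.symm.toEmbedding) := by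
    intro x hx
    replace hx := (Finset.mem_filter.1 hx).2
    simp only [hI, Equiv.Perm.mul_apply, Finset.mem_union, Finset.mem_map_equiv,
      Equiv.symm_symm, Finset.mem_inter, Equiv.Perm.mem_support] at hx ⊢
    by_cases h1 : a x = x <;> by_cases h2 : b x = x
    · simp [h1, h2] at hx
    · refine .inr (.inr ⟨?_, fun h => h2 (b.injective h)⟩)
      rwa [h1] at hx
    · refine .inr (.inl ⟨fun h => h1 (a.injective h), ?_⟩)
      rw [h2] at hx
      exact hx.symm
    · exact .inl ⟨h1, h2⟩
  have h1 : hammingDist ⇑(a * b) ⇑(b * a) ≤ _ := Finset.card_le_card hcover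
  have h2 := Finset.card_union_le I (I.map a.symm.toEmbedding ∪ I.map b.symm.toEmbedding)
  have h3 := Finset.card_union_le (I.map a.symm.toEmbedding) (I.map b.symm.toEmbedding)
  rw [Finset.card_map, Finset.card_map] at h3
  omega

/-- If `a` maps the support of `c` off itself, then `a` and `c` commute at no point of that support. -/
theorem card_support_le_hammingDist_mul_comm {a c : Equiv.Perm α}
    (h : ∀ x ∈ c.support, a x ∉ c.support) :
    c.support.card ≤ hammingDist ⇑(a * c) ⇑(c * a) := by
  refine Finset.card_le_card fun x hx => ?_
  refine Finset.mem_filter.2 ⟨Finset.mem_univ x, fun h' => ?_⟩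
  rw [Equiv.Perm.mul_apply, Equiv.Perm.mul_apply, Equiv.Perm.notMem_support.1 (h x hx)] at h'
  exact Equiv.Perm.mem_support.1 hx (a.injective h')

/-- A permutation `a` that almost commutes with the conjugates of an involution `b` almost commutes
with the products of two of them. Those include free involutions of sets disjoint from their
`a`-images, which forces the support of `a` or of `b` to be small. -/
theorem exists_conj_hammingDist_mul_comm (a : Equiv.Perm α) {b : Equiv.Perm α} (hb : b * b = 1) :
    ∃ g h : Equiv.Perm α, min a.support.card b.support.card ≤
      3 * hammingDist ⇑(a * (g * b * g⁻¹ * (h * b * h⁻¹)))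
        ⇑(g * b * g⁻¹ * (h * b * h⁻¹) * a) + 9 := by
  obtain ⟨B, -, hB, hBa⟩ := exists_subset_disjoint_image a a.support
    fun x hx => Equiv.Perm.mem_support.1 hx
  obtain ⟨Z, hZB, hZ⟩ := Finset.exists_subset_card_eq (s := B)
    (n := 4 * (min B.card b.support.card / 4)) (by omega)
  obtain ⟨y, z, hy, hz, hyz, hys, hzs, hyzs⟩ := exists_klein Z _ hZ
  have hle := Finset.card_le_univ b.support
  have hbc := card_support_of_mul_self hb
  obtain ⟨r, hr, hrs, hd⟩ := exists_involution_disjoint Z ((b.support.card - Z.card) / 2) (by omega)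
  have hyr := Equiv.Perm.disjoint_iff_disjoint_support.2 (hys ▸ hd)
  have hzr := Equiv.Perm.disjoint_iff_disjoint_support.2 (hzs ▸ hd)
  obtain ⟨g, hg⟩ := isConj_iff.1 (isConj_of_card_support_eq hb
    (mul_self_mul_of_commute hyr.commute hy hr) (by rw [hyr.card_support_mul, hys]; omega))
  obtain ⟨h, hh⟩ := isConj_iff.1 (isConj_of_card_support_eq hb
    (mul_self_mul_of_commute hzr.symm.commute hr hz)
    (by rw [hzr.symm.card_support_mul, hzs]; omega))
  refine ⟨g, h, ?_⟩
  rw [hg, hh, mul_assoc y, ← mul_assoc r, hr, one_mul]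
  have := card_support_le_hammingDist_mul_comm (a := a) (c := y * z) fun x hx hax =>
    hBa x (hZB (hyzs ▸ hx)) (hZB (hyzs ▸ hax))
  rw [hyzs] at this
  omega

/-- Cutting a permutation down to the set where it squares to the identity. -/
theorem exists_involution_near (a : Equiv.Perm α) :
    ∃ b : Equiv.Perm α, b * b = 1 ∧
      hammingDist ⇑b ⇑a ≤ (a * a).support.card := by
  have hinv : Function.Involutive fun x => if a (a x) = x then a x else x := by
    intro x
    by_cases h : a (a x) = x <;> simp [h]
  refine ⟨hinv.toPerm, Equiv.ext hinv, Finset.card_le_card fun x hx => ?_⟩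
  refine Equiv.Perm.mem_support.2 fun h => (Finset.mem_filter.1 hx).2 ?_
  exact if_pos h

end Finite

/-! ### The pseudometrics and orthogonality -/

section Basic

variable {k : ℕ → ℕ}

theorem hamming_one {m : ℕ} (σ : Equiv.Perm (Fin m)) :
    hamming σ 1 = (σ.support.card : ℝ) / m := rfl

theorem hamming_conj_one {m : ℕ} (g σ : Equiv.Perm (Fin m)) :
    hamming (g * σ * g⁻¹) 1 = hamming σ 1 := by
  rw [hamming_one, hamming_one, Equiv.Perm.card_support_conj]

theorem hamming_mul_one_le {m : ℕ} (σ τ : Equiv.Perm (Fin m)) :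
    hamming (σ * τ) 1 ≤ hamming σ 1 + hamming τ 1 := by
  have h := hamming_triangle (σ * τ) σ 1
  have h2 := hamming_mul_left σ τ 1
  rw [mul_one] at h2
  linarith

theorem hamming_inv_mul {m : ℕ} (σ τ : Equiv.Perm (Fin m)) :
    hamming (τ⁻¹ * σ) 1 = hamming σ τ := by
  rw [← hamming_mul_left τ, mul_inv_cancel_left, mul_one]

/-- The filter of tails of `S`: the index runs to infinity through `S`. -/
abbrev tails (S : Set ℕ) : Filter ℕ := cofinite ⊓ 𝓟 S

/-- The class in `𝒫(ℕ)/Fin` of a set of natural numbers. -/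
abbrev setClass (S : Set ℕ) : PFin := ((fun n => n ∈ S : ℕ → Prop) : PFin)

theorem exists_setClass (S : PFin) : ∃ T : Set ℕ, S = setClass T := by
  induction S using Filter.Germ.inductionOn with
  | _ p => exact ⟨{n | p n}, rfl⟩

theorem setClass_le_iff {S T : Set ℕ} :
    setClass S ≤ setClass T ↔ ∀ᶠ n in cofinite, n ∈ S → n ∈ T := Iff.rfl

theorem setClass_mono {S T : Set ℕ} (h : S ⊆ T) : setClass S ≤ setClass T :=
  setClass_le_iff.2 (Eventually.of_forall h)

theorem setClass_ne_bot_iff {S : Set ℕ} : setClass S ≠ ⊥ ↔ S.Infinite := by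
  rw [ne_eq, ← le_bot_iff, ← not_iff_not, not_not, Set.not_infinite]
  change (∀ᶠ n in cofinite, n ∈ S → False) ↔ _
  simp [Filter.eventually_cofinite]

theorem tails_neBot_iff {S : Set ℕ} : (tails S).NeBot ↔ S.Infinite := by
  rw [cofinite_inf_principal_neBot_iff]

theorem symDist_setClass (S : Set ℕ) (a b : ∀ n, Equiv.Perm (Fin (k n))) :
    symDist (setClass S) (a : SymRed k) (b : SymRed k) =
      limsup (fun n => hamming (a n) (b n)) (tails S) := rfl

theorem isBoundedUnder_hamming (f : Filter ℕ) (a b : ∀ n, Equiv.Perm (Fin (k n))) :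
    f.IsBoundedUnder (· ≤ ·) fun n => hamming (a n) (b n) :=
  isBoundedUnder_of ⟨1, fun _ => hamming_le_one _ _⟩

theorem isCoboundedUnder_hamming (f : Filter ℕ) [f.NeBot] (a b : ∀ n, Equiv.Perm (Fin (k n))) :
    f.IsCoboundedUnder (· ≤ ·) fun n => hamming (a n) (b n) :=
  isCoboundedUnder_le_of_le f fun _ => hamming_nonneg _ _

theorem symDist_setClass_of_finite {S : Set ℕ} (hS : S.Finite) (x y : SymRed k) :
    symDist (setClass S) x y = 0 := by
  induction x using QuotientGroup.induction_on with | _ a =>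
  induction y using QuotientGroup.induction_on with | _ b =>
  have : tails S = ⊥ := by
    rw [← not_neBot, tails_neBot_iff, Set.not_infinite]; exact hS
  rw [symDist_setClass, this]
  simp [limsup, limsSup]

theorem symDist_le_iff {S : Set ℕ} (hS : S.Infinite) {a b : ∀ n, Equiv.Perm (Fin (k n))} {c : ℝ} :
    symDist (setClass S) (a : SymRed k) (b : SymRed k) ≤ c ↔
      ∀ d, c < d → ∀ᶠ n in tails S, hamming (a n) (b n) < d := by
  have := tails_neBot_iff.2 hS
  rw [symDist_setClass]
  exact limsup_le_iff (isCoboundedUnder_hamming _ a b) (isBoundedUnder_hamming _ a b)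

theorem symDist_le_of_eventually {S : Set ℕ} (hS : S.Infinite)
    {a b : ∀ n, Equiv.Perm (Fin (k n))} {c : ℝ}
    (h : ∀ᶠ n in tails S, hamming (a n) (b n) ≤ c) :
    symDist (setClass S) (a : SymRed k) (b : SymRed k) ≤ c :=
  (symDist_le_iff hS).2 fun _ hd => h.mono fun _ hn => hn.trans_lt hd

theorem le_symDist_of_eventually {S : Set ℕ} (hS : S.Infinite)
    {a b : ∀ n, Equiv.Perm (Fin (k n))} {c : ℝ}
    (h : ∀ᶠ n in tails S, c ≤ hamming (a n) (b n)) :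
    c ≤ symDist (setClass S) (a : SymRed k) (b : SymRed k) := by
  have := tails_neBot_iff.2 hS
  rw [symDist_setClass]
  exact le_limsup_of_frequently_le h.frequently (isBoundedUnder_hamming _ a b)

theorem exists_infinite_subset_of_lt_symDist {S : Set ℕ} (hS : S.Infinite)
    {a b : ∀ n, Equiv.Perm (Fin (k n))} {c : ℝ}
    (h : c < symDist (setClass S) (a : SymRed k) (b : SymRed k)) :
    ∃ T ⊆ S, T.Infinite ∧ ∀ n ∈ T, c < hamming (a n) (b n) := by
  have := tails_neBot_iff.2 hS
  rw [symDist_setClass] at h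
  have h1 := frequently_lt_of_lt_limsup (isCoboundedUnder_hamming _ a b) h
  rw [frequently_inf_principal, frequently_cofinite_iff_infinite] at h1
  exact ⟨_, fun n hn => hn.1, h1, fun n hn => hn.2⟩

theorem symDist_nonneg (S : PFin) (x y : SymRed k) : 0 ≤ symDist S x y := by
  obtain ⟨S, rfl⟩ := exists_setClass S
  induction x using QuotientGroup.induction_on with | _ a =>
  induction y using QuotientGroup.induction_on with | _ b =>
  by_cases hS : S.Infinite
  · exact le_symDist_of_eventually hS (Eventually.of_forall fun n => hamming_nonneg _ _)
  · exact (symDist_setClass_of_finite (Set.not_infinite.1 hS) _ _).ge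

theorem symDist_eq_zero_iff {S : Set ℕ} {a b : ∀ n, Equiv.Perm (Fin (k n))} :
    symDist (setClass S) (a : SymRed k) (b : SymRed k) = 0 ↔
      Tendsto (fun n => hamming (a n) (b n)) (tails S) (𝓝 0) := by
  by_cases hS : S.Infinite
  · have := tails_neBot_iff.2 hS
    refine ⟨fun h => ?_, fun h => h.limsup_eq⟩
    exact tendsto_order.2 ⟨fun x hx => Eventually.of_forall fun n =>
      hx.trans_le (hamming_nonneg _ _), (symDist_le_iff hS).1 h.le⟩
  · have : tails S = ⊥ := by
      rw [← not_neBot, tails_neBot_iff]; exact hS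
    simp [symDist_setClass_of_finite (Set.not_infinite.1 hS), this]

theorem tails_univ : tails Set.univ = cofinite := by simp [tails]

theorem mk_eq_mk_iff {a b : ∀ n, Equiv.Perm (Fin (k n))} :
    (a : SymRed k) = (b : SymRed k) ↔
      Tendsto (fun n => hamming (a n) (b n)) cofinite (𝓝 0) := by
  rw [eq_comm, QuotientGroup.eq]
  change limsup (fun n => hamming ((b n)⁻¹ * a n) 1) atTop = 0 ↔ _
  rw [limsup_eq_zero_iff (fun n => (b n)⁻¹ * a n), Nat.cofinite_eq_atTop]
  simp only [hamming_inv_mul]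

theorem symDist_eq_symDist_one (S : PFin) (x y : SymRed k) :
    symDist S x y = symDist S (y⁻¹ * x) 1 := by
  obtain ⟨S, rfl⟩ := exists_setClass S
  induction x using QuotientGroup.induction_on with | _ a =>
  induction y using QuotientGroup.induction_on with | _ b =>
  rw [← QuotientGroup.mk_inv, ← QuotientGroup.mk_mul, ← QuotientGroup.mk_one, symDist_setClass,
    symDist_setClass]
  simp [hamming_inv_mul]

theorem symDist_mul_one_le (S : PFin) (x y : SymRed k) :
    symDist S (x * y) 1 ≤ symDist S x 1 + symDist S y 1 := by
  obtain ⟨S, rfl⟩ := exists_setClass S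
  induction x using QuotientGroup.induction_on with | _ a =>
  induction y using QuotientGroup.induction_on with | _ b =>
  by_cases hS : S.Infinite
  · rw [← QuotientGroup.mk_mul, ← QuotientGroup.mk_one]
    refine (symDist_le_iff hS).2 fun d hd => ?_
    set u := symDist (setClass S) (a : SymRed k) ((1 : ∀ n, Equiv.Perm (Fin (k n))) : SymRed k)
    set v := symDist (setClass S) (b : SymRed k) ((1 : ∀ n, Equiv.Perm (Fin (k n))) : SymRed k)
    filter_upwards [(symDist_le_iff hS).1 (le_refl u) (u + (d - (u + v)) / 2) (by linarith),
      (symDist_le_iff hS).1 (le_refl v) (v + (d - (u + v)) / 2) (by linarith)] with n h1 h2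
    have := hamming_mul_one_le (a n) (b n)
    simp only [Pi.mul_apply, Pi.one_apply] at *
    linarith
  · simp [symDist_setClass_of_finite (Set.not_infinite.1 hS)]

theorem symDist_conj_one (S : PFin) (g x : SymRed k) :
    symDist S (g * x * g⁻¹) 1 = symDist S x 1 := by
  obtain ⟨S, rfl⟩ := exists_setClass S
  induction x using QuotientGroup.induction_on with | _ a =>
  induction g using QuotientGroup.induction_on with | _ b =>
  rw [← QuotientGroup.mk_inv, ← QuotientGroup.mk_mul, ← QuotientGroup.mk_mul,
    ← QuotientGroup.mk_one, symDist_setClass, symDist_setClass]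
  simp [hamming_conj_one]

theorem symDist_inv_one (S : PFin) (x : SymRed k) : symDist S x⁻¹ 1 = symDist S x 1 := by
  obtain ⟨S, rfl⟩ := exists_setClass S
  induction x using QuotientGroup.induction_on with | _ a =>
  rw [← QuotientGroup.mk_inv, ← QuotientGroup.mk_one, symDist_setClass, symDist_setClass]
  congr 1
  funext n
  have := hamming_inv_mul 1 (a n)
  rw [mul_one, hamming_comm] at this
  rw [Pi.inv_apply, Pi.one_apply, hamming_comm, this, hamming_comm]

theorem symDist_self (S : PFin) (x : SymRed k) : symDist S x x = 0 := by
  obtain ⟨S, rfl⟩ := exists_setClass S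
  induction x using QuotientGroup.induction_on with | _ a =>
  rw [symDist_eq_zero_iff]
  simpa [hamming_self] using tendsto_const_nhds

theorem top_eq_setClass : (⊤ : PFin) = setClass Set.univ :=
  le_antisymm (setClass_le_iff.2 (Eventually.of_forall fun _ _ => trivial) :
    setClass Set.univ ≤ setClass Set.univ) le_top

theorem symMetric_eq_symDist_top (x y : SymRed k) : symMetric x y = symDist ⊤ x y := by
  induction x using QuotientGroup.induction_on with | _ a =>
  induction y using QuotientGroup.induction_on with | _ b =>
  rw [top_eq_setClass, symDist_setClass, tails_univ, Nat.cofinite_eq_atTop]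
  rfl

open scoped Pointwise in
theorem symDist_le_of_mem_conjugatesOf_pow (S : PFin) {s x : SymRed k} {q : ℕ}
    (hx : x ∈ conjugatesOf s ^ q) : symDist S x 1 ≤ q * symDist S s 1 := by
  induction q generalizing x with
  | zero =>
    rw [pow_zero, Set.mem_one] at hx
    simp [hx, symDist_self]
  | succ q ih =>
    rw [pow_succ] at hx
    obtain ⟨y, hy, z, hz, rfl⟩ := Set.mem_mul.1 hx
    obtain ⟨g, rfl⟩ := isConj_iff.1 hz
    have h1 := symDist_mul_one_le S y (g * s * g⁻¹)
    have h2 := ih hy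
    rw [symDist_conj_one] at h1
    push_cast
    linarith

theorem exists_involution_lift {x : SymRed k} (hx : x * x = 1) :
    ∃ a : ∀ n, Equiv.Perm (Fin (k n)), (∀ n, a n * a n = 1) ∧ (a : SymRed k) = x := by
  induction x using QuotientGroup.induction_on with | _ a =>
  choose b hb1 hb2 using fun n => exists_involution_near (a n)
  refine ⟨b, hb1, ?_⟩
  rw [← QuotientGroup.mk_mul, ← QuotientGroup.mk_one, mk_eq_mk_iff] at hx
  rw [mk_eq_mk_iff]
  refine squeeze_zero (fun n => hamming_nonneg _ _) (fun n => ?_) hx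
  rw [Pi.mul_apply, Pi.one_apply, hamming_one, hamming]
  gcongr
  exact hb2 n

theorem mk_mul_self {a : ∀ n, Equiv.Perm (Fin (k n))} (ha : ∀ n, a n * a n = 1) :
    (a : SymRed k) * (a : SymRed k) = 1 := by
  rw [← QuotientGroup.mk_mul, show a * a = 1 from funext ha, QuotientGroup.mk_one]

theorem tendsto_const_div (hk : Tendsto k atTop atTop) (c : ℝ) :
    Tendsto (fun n => c / (k n : ℝ)) cofinite (𝓝 0) := by
  rw [Nat.cofinite_eq_atTop]
  exact tendsto_const_nhds.div_atTop (tendsto_natCast_atTop_atTop.comp hk)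

/-- Orthogonality: `x` commutes with all conjugates of `y`, hence with their normal closure. -/
def Orth {G : Type*} [Group G] (x y : G) : Prop := ∀ g, Commute x (g * y * g⁻¹)

theorem orth_map_iff {G H : Type*} [Group G] [Group H] (φ : G ≃* H) {x y : G} :
    Orth (φ x) (φ y) ↔ Orth x y := by
  constructor
  · intro h g
    have := h (φ g)
    rw [← map_inv, ← map_mul, ← map_mul] at this
    simpa using this.map φ.symm
  · intro h g
    have := (h (φ.symm g)).map φ
    simpa using this

/-- Orthogonality to an involution in terms of lengths: the commutator of `a` and a conjugate of `b` is
null if one of the two lengths is small, and the converse is `exists_conj_hammingDist_mul_comm`. -/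
theorem orth_iff_tendsto (hk : Tendsto k atTop atTop) {a b : ∀ n, Equiv.Perm (Fin (k n))}
    (hb : ∀ n, b n * b n = 1) :
    Orth (a : SymRed k) (b : SymRed k) ↔
      Tendsto (fun n => min (hamming (a n) 1) (hamming (b n) 1)) cofinite (𝓝 0) := by
  constructor
  · intro h
    choose g g' hg using fun n => exists_conj_hammingDist_mul_comm (a n) (hb n)
    have h1 : (a : SymRed k) * (((g * b * g⁻¹ * (g' * b * g'⁻¹) :
        ∀ n, Equiv.Perm (Fin (k n)))) : SymRed k) = ((g * b * g⁻¹ * (g' * b * g'⁻¹) :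
        ∀ n, Equiv.Perm (Fin (k n))) : SymRed k) * (a : SymRed k) :=
      (h (g : SymRed k)).mul_right (h (g' : SymRed k))
    rw [← QuotientGroup.mk_mul, ← QuotientGroup.mk_mul, mk_eq_mk_iff] at h1
    have h2 := (h1.const_mul 3).add (tendsto_const_div hk 9)
    rw [mul_zero, zero_add] at h2
    refine squeeze_zero (fun n => le_min (hamming_nonneg _ _) (hamming_nonneg _ _))
      (fun n => ?_) h2
    have h3 : (min ((a n).support.card : ℝ) ((b n).support.card : ℝ)) ≤
        3 * (hammingDist ⇑(a n * (g n * b n * (g n)⁻¹ * (g' n * b n * (g' n)⁻¹)))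
        ⇑(g n * b n * (g n)⁻¹ * (g' n * b n * (g' n)⁻¹) * a n) : ℝ) + 9 := by
      exact_mod_cast hg n
    rw [hamming_one, hamming_one, min_div_div_right (Nat.cast_nonneg (k n)), hamming, ← mul_div_assoc,
      ← add_div]
    gcongr
    exact h3
  · intro h g
    induction g using QuotientGroup.induction_on with | _ g =>
    change (a : SymRed k) * ((g * b * g⁻¹ : ∀ n, Equiv.Perm (Fin (k n))) : SymRed k) =
      ((g * b * g⁻¹ : ∀ n, Equiv.Perm (Fin (k n))) : SymRed k) * (a : SymRed k)
    rw [← QuotientGroup.mk_mul, ← QuotientGroup.mk_mul, mk_eq_mk_iff]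
    have h2 := h.const_mul 3
    rw [mul_zero] at h2
    refine squeeze_zero (fun n => hamming_nonneg _ _) (fun n => ?_) h2
    rw [← hamming_conj_one (g n) (b n), hamming_one, hamming_one,
      min_div_div_right (Nat.cast_nonneg (k n)), hamming, ← mul_div_assoc]
    gcongr
    have h3 := hammingDist_mul_comm_le (a n) (g n * b n * (g n)⁻¹)
    have h4 := Finset.card_le_card (Finset.inter_subset_left
      (s₁ := (a n).support) (s₂ := (g n * b n * (g n)⁻¹).support))
    have h5 := Finset.card_le_card (Finset.inter_subset_right
      (s₁ := (a n).support) (s₂ := (g n * b n * (g n)⁻¹).support))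
    have h6 : hammingDist ⇑(a n * (g n * b n * (g n)⁻¹)) ⇑(g n * b n * (g n)⁻¹ * a n) ≤
        3 * min (a n).support.card (g n * b n * (g n)⁻¹).support.card := by omega
    exact_mod_cast h6

end Basic

/-! ### The induced automorphism -/

section Induced

variable {k l : ℕ → ℕ}

/-- An involution moving all points but at most one at the indices in `S`, and none elsewhere. -/
theorem exists_full_involution (k : ℕ → ℕ) (S : Set ℕ) :
    ∃ e : ∀ n, Equiv.Perm (Fin (k n)), (∀ n, e n * e n = 1) ∧
      (∀ n ∈ S, k n ≤ (e n).support.card + 1) ∧ ∀ n ∉ S, e n = 1 := by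
  classical
  choose τ h1 _ h3 using fun n => exists_involution_support_subset (Finset.univ : Finset (Fin (k n)))
  refine ⟨fun n => if n ∈ S then τ n else 1, fun n => ?_, fun n hn => ?_, fun n hn => if_neg hn⟩
  · by_cases hn : n ∈ S <;> simp [hn, h1]
  · simpa [hn] using h3 n

theorem eventually_le_full_involution (hk : Tendsto k atTop atTop) {S : Set ℕ}
    {e : ∀ n, Equiv.Perm (Fin (k n))} (he : ∀ n ∈ S, k n ≤ (e n).support.card + 1)
    {c : ℝ} (hc : c < 1) :
    ∀ᶠ n in tails S, c ≤ hamming (e n) 1 := by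
  have h : ∀ᶠ n in tails S, 1 / (1 - c) ≤ (k n : ℝ) := by
    refine Filter.Eventually.filter_mono (inf_le_left : tails S ≤ cofinite) ?_
    rw [Nat.cofinite_eq_atTop]
    exact (tendsto_natCast_atTop_atTop.comp hk).eventually_ge_atTop _
  filter_upwards [h, mem_inf_of_right (mem_principal_self S)] with n h1 h2
  have hc' : 0 < 1 - c := by linarith
  have h0 : (0 : ℝ) < k n := (by positivity : 0 < 1 / (1 - c)).trans_le h1
  have h4 : (k n : ℝ) ≤ (e n).support.card + 1 := by exact_mod_cast he n h2
  rw [div_le_iff₀ hc'] at h1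
  rw [hamming_one, le_div_iff₀ h0]
  linarith

/-- The elements that are null along `S` determine `S` and its position in the order. -/
theorem le_iff_forall_symDist_eq_zero (hk : Tendsto k atTop atTop) {S T : PFin} :
    S ≤ T ↔ ∀ x : SymRed k, symDist T x 1 = 0 → symDist S x 1 = 0 := by
  obtain ⟨S, rfl⟩ := exists_setClass S
  obtain ⟨T, rfl⟩ := exists_setClass T
  constructor
  · intro h x hx
    induction x using QuotientGroup.induction_on with | _ a =>
    rw [← QuotientGroup.mk_one, symDist_eq_zero_iff] at hx ⊢
    refine hx.mono_left (le_inf inf_le_left (le_principal_iff.2 ?_))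
    exact mem_inf_principal.2 (setClass_le_iff.1 h)
  · intro h
    obtain ⟨e, -, he2, he3⟩ := exists_full_involution k Tᶜ
    have h1 := h (e : SymRed k)
    rw [← QuotientGroup.mk_one, symDist_eq_zero_iff, symDist_eq_zero_iff] at h1
    have h2 := h1 (by
      refine Tendsto.congr' ?_ tendsto_const_nhds
      filter_upwards [mem_inf_of_right (mem_principal_self T)] with n hn
      rw [he3 n (by simpa using hn), Pi.one_apply, hamming_self])
    rw [setClass_le_iff]
    have h3 := eventually_inf_principal.1 (eventually_le_full_involution hk he2 one_half_lt_one)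
    have h4 := eventually_inf_principal.1 (h2.eventually (gt_mem_nhds (by norm_num : (0:ℝ) < 1 / 2)))
    filter_upwards [h3, h4] with n h5 h6 hn
    by_contra hcon
    have := h5 hcon
    have := h6 hn
    rw [Pi.one_apply] at this
    linarith

theorem eq_of_forall_symDist_eq_zero_iff (hk : Tendsto k atTop atTop) {S T : PFin}
    (h : ∀ x : SymRed k, symDist S x 1 = 0 ↔ symDist T x 1 = 0) : S = T :=
  le_antisymm ((le_iff_forall_symDist_eq_zero hk).2 fun x => (h x).2)
    ((le_iff_forall_symDist_eq_zero hk).2 fun x => (h x).1)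

theorem tendsto_min_of_tails {u v : ℕ → ℝ} (hu : ∀ n, 0 ≤ u n) (hv : ∀ n, 0 ≤ v n)
    {S : Set ℕ} (h1 : Tendsto u (tails S) (𝓝 0)) (h2 : Tendsto v (tails Sᶜ) (𝓝 0)) :
    Tendsto (fun n => min (u n) (v n)) cofinite (𝓝 0) := by
  have h : (cofinite : Filter ℕ) = tails S ⊔ tails Sᶜ := by
    rw [tails, tails, ← inf_sup_left, sup_principal, Set.union_compl_self, principal_univ, inf_top_eq]
  rw [h, tendsto_sup]
  exact ⟨squeeze_zero (fun n => le_min (hu n) (hv n)) (fun n => min_le_left _ _) h1,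
    squeeze_zero (fun n => le_min (hu n) (hv n)) (fun n => min_le_right _ _) h2⟩

/-- If two orthogonal involutions have no nontrivial common orthogonal element, then the elements
orthogonal to the first are those null along some `S`, namely along the set of indices where the
first involution is the longer one. -/
theorem exists_orth_iff (hk : Tendsto k atTop atTop) {y z : SymRed k} (hy : y * y = 1)
    (hz : z * z = 1) (hyz : Orth y z) (h : ∀ x, Orth x y → Orth x z → x = 1) :
    ∃ S : PFin, ∀ x, Orth x y ↔ symDist S x 1 = 0 := by
  obtain ⟨b, hb, rfl⟩ := exists_involution_lift hy
  obtain ⟨c, hc, rfl⟩ := exists_involution_lift hz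
  rw [orth_iff_tendsto hk hc] at hyz
  refine ⟨setClass {n | hamming (c n) 1 ≤ hamming (b n) 1}, fun x => ?_⟩
  induction x using QuotientGroup.induction_on with | _ a =>
  rw [← QuotientGroup.mk_one, symDist_eq_zero_iff, orth_iff_tendsto hk hb]
  constructor
  · intro hab
    rw [tendsto_order]
    refine ⟨fun d hd => Eventually.of_forall fun n => hd.trans_le (hamming_nonneg _ _),
      fun d hd => ?_⟩
    rw [← not_not (a := ∀ᶠ n in _, _), not_eventually]
    intro hfr
    rw [frequently_inf_principal, frequently_cofinite_iff_infinite] at hfr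
    set T := {n | n ∈ {n | hamming (c n) 1 ≤ hamming (b n) 1} ∧
      ¬ hamming (a n) ((1 : ∀ n, Equiv.Perm (Fin (k n))) n) < d} with hT
    have hmem : ∀ᶠ n in tails T, n ∈ T := mem_inf_of_right (mem_principal_self T)
    -- Along `T` the length of `a` stays above `d`, so `b` is null there, and `c` is shorter than `b`;
    -- a full involution on `T` is then orthogonal to both.
    have hb0 : Tendsto (fun n => hamming (b n) 1) (tails T) (𝓝 0) := by
      rw [tendsto_order]
      refine ⟨fun d hd => Eventually.of_forall fun n => hd.trans_le (hamming_nonneg _ _),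
        fun d' hd' => ?_⟩
      filter_upwards [(hab.mono_left (inf_le_left : tails T ≤ cofinite)).eventually
        (gt_mem_nhds (lt_min hd hd')), hmem] with n h1 h2
      have h3 : d ≤ hamming (a n) 1 := not_lt.1 h2.2
      rcases min_lt_iff.1 h1 with h4 | h4
      · exact absurd (h4.trans_le (min_le_left _ _)) (not_lt.2 h3)
      · exact h4.trans_le (min_le_right _ _)
    have hc0 : Tendsto (fun n => hamming (c n) 1) (tails T) (𝓝 0) :=
      squeeze_zero' (Eventually.of_forall fun n => hamming_nonneg _ _)
        (hmem.mono fun n hn => hn.1) hb0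
    obtain ⟨e, -, he2, he3⟩ := exists_full_involution k T
    have hemin : Tendsto (fun n => hamming (e n) 1) (tails Tᶜ) (𝓝 0) := by
      refine Tendsto.congr' ?_ tendsto_const_nhds
      filter_upwards [mem_inf_of_right (mem_principal_self Tᶜ)] with n hn
      rw [he3 n hn, hamming_self]
    have he : (e : SymRed k) = 1 := by
      refine h _ ((orth_iff_tendsto hk hb).2 ?_) ((orth_iff_tendsto hk hc).2 ?_)
      · simpa only [min_comm] using tendsto_min_of_tails (fun n => hamming_nonneg _ _)
          (fun n => hamming_nonneg _ _) hb0 hemin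
      · simpa only [min_comm] using tendsto_min_of_tails (fun n => hamming_nonneg _ _)
          (fun n => hamming_nonneg _ _) hc0 hemin
    rw [← QuotientGroup.mk_one, mk_eq_mk_iff] at he
    have := tails_neBot_iff.2 hfr
    obtain ⟨n, h1, h2⟩ := ((eventually_le_full_involution hk he2 one_half_lt_one).and
      ((he.mono_left (inf_le_left : tails T ≤ cofinite)).eventually
      (gt_mem_nhds (by norm_num : (0 : ℝ) < 1 / 2)))).exists
    rw [Pi.one_apply] at h2
    linarith
  · intro ha
    refine tendsto_min_of_tails (fun n => hamming_nonneg _ _)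
      (fun n => hamming_nonneg _ _) ha ?_
    refine squeeze_zero' (Eventually.of_forall fun n => hamming_nonneg _ _) ?_
      (hyz.mono_left inf_le_left)
    filter_upwards [mem_inf_of_right (mem_principal_self _)] with n hn
    exact le_min le_rfl (le_of_not_ge hn)

/-- The pair of full involutions on `S` and on its complement has the property of `exists_orth_iff`. -/
theorem exists_orth_pair (hk : Tendsto k atTop atTop) (S : PFin) :
    ∃ y z : SymRed k, y * y = 1 ∧ z * z = 1 ∧ Orth y z ∧ (∀ x, Orth x y → Orth x z → x = 1) ∧
      ∀ x, Orth x y ↔ symDist S x 1 = 0 := by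
  obtain ⟨S, rfl⟩ := exists_setClass S
  obtain ⟨b, hb1, hb2, hb3⟩ := exists_full_involution k S
  obtain ⟨c, hc1, hc2, hc3⟩ := exists_full_involution k Sᶜ
  have key : ∀ (T : Set ℕ) (e : ∀ n, Equiv.Perm (Fin (k n))), (∀ n, e n * e n = 1) →
      (∀ n ∈ T, k n ≤ (e n).support.card + 1) → (∀ n ∉ T, e n = 1) →
      ∀ a : ∀ n, Equiv.Perm (Fin (k n)), Orth (a : SymRed k) (e : SymRed k) ↔
        Tendsto (fun n => hamming (a n) 1) (tails T) (𝓝 0) := by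
    intro T e he1 he2 he3 a
    rw [orth_iff_tendsto hk he1]
    constructor
    · intro h
      rw [tendsto_order]
      refine ⟨fun d hd => Eventually.of_forall fun n => hd.trans_le (hamming_nonneg _ _),
        fun d hd => ?_⟩
      filter_upwards [(h.mono_left (inf_le_left : tails T ≤ cofinite)).eventually
        (gt_mem_nhds (lt_min hd (by norm_num : (0 : ℝ) < 1 / 2))),
        eventually_le_full_involution hk he2 one_half_lt_one] with n h1 h2
      rcases min_lt_iff.1 h1 with h4 | h4
      · exact h4.trans_le (min_le_left _ _)
      · exact absurd (h4.trans_le (min_le_right _ _)) (not_lt.2 h2)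
    · intro h
      refine tendsto_min_of_tails (fun n => hamming_nonneg _ _)
        (fun n => hamming_nonneg _ _) h ?_
      refine Tendsto.congr' ?_ tendsto_const_nhds
      filter_upwards [mem_inf_of_right (mem_principal_self _)] with n hn
      rw [he3 n hn, hamming_self]
  refine ⟨b, c, mk_mul_self hb1, mk_mul_self hc1, ?_, ?_, ?_⟩
  · rw [key _ c hc1 hc2 hc3]
    refine Tendsto.congr' ?_ tendsto_const_nhds
    filter_upwards [mem_inf_of_right (mem_principal_self _)] with n hn
    rw [hb3 n hn, hamming_self]
  · intro x h1 h2
    induction x using QuotientGroup.induction_on with | _ a =>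
    rw [key _ b hb1 hb2 hb3] at h1
    rw [key _ c hc1 hc2 hc3] at h2
    rw [← QuotientGroup.mk_one, mk_eq_mk_iff]
    simpa using tendsto_min_of_tails (fun n => hamming_nonneg _ _)
        (fun n => hamming_nonneg _ _) h1 h2
  · intro x
    induction x using QuotientGroup.induction_on with | _ a =>
    rw [key _ b hb1 hb2 hb3, ← QuotientGroup.mk_one, symDist_eq_zero_iff]
    rfl

/-- An isomorphism carries the subgroup of elements null along `S` to one of the same form. -/
theorem exists_symDist_eq_zero_iff (hk : Tendsto k atTop atTop) (hl : Tendsto l atTop atTop)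
    (φ : SymRed k ≃* SymRed l) (S : PFin) :
    ∃ T : PFin, ∀ x, symDist S x 1 = 0 ↔ symDist T (φ x) 1 = 0 := by
  obtain ⟨y, z, hy, hz, hyz, h1, h2⟩ := exists_orth_pair hk S
  obtain ⟨T, hT⟩ := exists_orth_iff hl (y := φ y) (z := φ z) (by rw [← map_mul, hy, map_one])
    (by rw [← map_mul, hz, map_one]) ((orth_map_iff φ).2 hyz) (by
      intro x hxy hxz
      obtain ⟨x, rfl⟩ := φ.surjective x
      rw [h1 x ((orth_map_iff φ).1 hxy) ((orth_map_iff φ).1 hxz), map_one])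
  exact ⟨T, fun x => by rw [← h2, ← hT, orth_map_iff]⟩

theorem exists_orderIso (hk : Tendsto k atTop atTop) (hl : Tendsto l atTop atTop)
    (φ : SymRed k ≃* SymRed l) :
    ∃ θ : PFin ≃o PFin, ∀ S x, symDist S x 1 = 0 ↔ symDist (θ S) (φ x) 1 = 0 := by
  choose f hf using exists_symDist_eq_zero_iff hk hl φ
  choose g hg using exists_symDist_eq_zero_iff hl hk φ.symm
  refine ⟨⟨⟨f, g, fun S => ?_, fun S => ?_⟩, fun {S T} => ?_⟩, hf⟩
  · refine eq_of_forall_symDist_eq_zero_iff hk fun x => ?_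
    rw [hf S x, hg (f S), φ.symm_apply_apply]
  · refine eq_of_forall_symDist_eq_zero_iff hl fun x => ?_
    rw [hg S x, hf (g S), φ.apply_symm_apply]
  · change f S ≤ f T ↔ S ≤ T
    rw [le_iff_forall_symDist_eq_zero (S := S) hk, le_iff_forall_symDist_eq_zero (S := f S) hl,
      φ.surjective.forall]
    exact forall_congr' fun x => by rw [hf S, hf T]

/-- It suffices to compare with `1`, and the condition extends to `S = ⊥`: along a finite set the limit
superior is taken over the trivial filter, where its value in `ℝ` is `0`. -/
theorem induces_iff {φ : SymRed k ≃* SymRed l} {θ : PFin ≃o PFin} :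
    Induces φ θ ↔ ∀ S x, symDist S x 1 = 0 ↔ symDist (θ S) (φ x) 1 = 0 := by
  constructor
  · intro h S x
    by_cases hS : S = ⊥
    · subst hS
      have h0 : (⊥ : PFin) = setClass ∅ := by
        by_contra hcon
        exact Set.not_infinite.2 Set.finite_empty (setClass_ne_bot_iff.1 (Ne.symm hcon))
      rw [θ.map_bot, h0, symDist_setClass_of_finite Set.finite_empty,
        symDist_setClass_of_finite Set.finite_empty]
    · rw [h S hS, map_one]
  · intro h S _ a b
    rw [symDist_eq_symDist_one, h, symDist_eq_symDist_one (θ S) (φ a), map_mul, map_inv]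

theorem Induces.symm {φ : SymRed k ≃* SymRed l} {θ : PFin ≃o PFin} (h : Induces φ θ) :
    Induces φ.symm θ.symm := by
  rw [induces_iff] at h ⊢
  intro S x
  rw [h]; simp

theorem existsUnique_induces (hk : Tendsto k atTop atTop) (hl : Tendsto l atTop atTop)
    (φ : SymRed k ≃* SymRed l) : ∃! θ : PFin ≃o PFin, Induces φ θ := by
  obtain ⟨θ, hθ⟩ := exists_orderIso hk hl φ
  refine ⟨θ, induces_iff.2 hθ, fun η hη => OrderIso.ext (funext fun S => ?_)⟩
  replace hη := induces_iff.1 hη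
  refine eq_of_forall_symDist_eq_zero_iff hl fun x => ?_
  obtain ⟨x, rfl⟩ := φ.surjective x
  rw [← hη, hθ]

end Induced

/-! ### Lengths of involutions -/

section Conjugates

open scoped Pointwise

/-- If `|π| ≤ q |σ|` with `q = 2 j ≥ 4`, then `π` is a product of `q` conjugates of `σ` up to `2 q`
points. The error comes from rounding the number of transpositions of `π` down to a multiple of
`q`. -/
theorem exists_mem_conjugatesOf_pow_near {α : Type*} [DecidableEq α] [Fintype α]
    {σ π : Equiv.Perm α} (hσ : σ * σ = 1) (hπ : π * π = 1) {j : ℕ} (hj : 2 ≤ j)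
    (h : π.support.card ≤ 2 * j * σ.support.card) :
    ∃ x ∈ conjugatesOf σ ^ (2 * j), hammingDist ⇑x ⇑π ≤ 4 * j := by
  have hs := card_support_of_mul_self hσ
  have hp := card_support_of_mul_self hπ
  have hle := Finset.card_le_univ π.support
  rw [hs, hp] at h
  set t := π.cycleType.card
  set u := σ.cycleType.card
  have hdiv := Nat.div_add_mod t (2 * j)
  have hmod := Nat.mod_lt t (by omega : 0 < 2 * j)
  have hcu : t / (2 * j) ≤ u := Nat.div_le_of_le_mul (by linarith)
  have hc4 : t / (2 * j) ≤ t / 4 := Nat.div_le_div_left (by omega) (by norm_num)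
  obtain ⟨p, q, hp1, hq1, hps, hqs, rfl⟩ := exists_mul_of_card_support hπ
    (2 * j * (t / (2 * j))) (t % (2 * j)) (by rw [hdiv, hp])
  refine ⟨p, mem_conjugatesOf_pow hσ hp1 hs (c := t / (2 * j)) (by rw [hps]; ring) hcu
    (by omega), ?_⟩
  calc hammingDist ⇑p ⇑(p * q) ≤ q.support.card := by
        refine Finset.card_le_card fun x hx => Equiv.Perm.mem_support.2 fun h => ?_
        exact (Finset.mem_filter.1 hx).2 (by rw [Equiv.Perm.mul_apply, h])
    _ ≤ 4 * j := by omega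

theorem map_mem_conjugatesOf_pow {G H : Type*} [Group G] [Group H] (φ : G →* H) {s x : G} {q : ℕ}
    (hx : x ∈ conjugatesOf s ^ q) : φ x ∈ conjugatesOf (φ s) ^ q := by
  induction q generalizing x with
  | zero =>
    rw [pow_zero, Set.mem_one] at hx ⊢
    rw [hx, map_one]
  | succ q ih =>
    rw [pow_succ] at hx ⊢
    obtain ⟨y, hy, z, hz, rfl⟩ := Set.mem_mul.1 hx
    rw [map_mul]
    exact Set.mul_mem_mul (ih hy) (φ.map_isConj hz)

theorem pi_mem_conjugatesOf_pow {ι : Type*} {G : ι → Type*} [∀ i, Group (G i)] {s x : ∀ i, G i}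
    {q : ℕ} (hx : ∀ i, x i ∈ conjugatesOf (s i) ^ q) : x ∈ conjugatesOf s ^ q := by
  induction q generalizing x with
  | zero =>
    simp only [pow_zero, Set.mem_one] at hx ⊢
    exact funext hx
  | succ q ih =>
    simp only [pow_succ, Set.mem_mul] at hx ⊢
    choose y hy z hz hyz using hx
    choose g hg using fun i => isConj_iff.1 (hz i)
    exact ⟨y, ih hy, z, isConj_iff.2 ⟨g, funext hg⟩, funext hyz⟩

variable {k l : ℕ → ℕ}

/-- If `|π| ≤ q |σ|` along `S`, for `q = 2 j ≥ 4`, then `π` coincides along `S` with a product of `q`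
conjugates of `σ`. -/
theorem exists_mem_conjugatesOf_pow_symDist_eq_zero (hk : Tendsto k atTop atTop)
    {s p : ∀ n, Equiv.Perm (Fin (k n))} (hs : ∀ n, s n * s n = 1) (hp : ∀ n, p n * p n = 1)
    {j : ℕ} (hj : 2 ≤ j) {S : Set ℕ}
    (h : ∀ᶠ n in tails S, (p n).support.card ≤ 2 * j * (s n).support.card) :
    ∃ x ∈ conjugatesOf (s : SymRed k) ^ (2 * j), symDist (setClass S) x (p : SymRed k) = 0 := by
  have H : ∀ n, ∃ x ∈ conjugatesOf (s n) ^ (2 * j),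
      (p n).support.card ≤ 2 * j * (s n).support.card → hammingDist ⇑x ⇑(p n) ≤ 4 * j := by
    intro n
    by_cases hn : (p n).support.card ≤ 2 * j * (s n).support.card
    · obtain ⟨x, hx1, hx2⟩ := exists_mem_conjugatesOf_pow_near (hs n) (hp n) hj hn
      exact ⟨x, hx1, fun _ => hx2⟩
    · exact ⟨s n ^ (2 * j), Set.pow_mem_pow mem_conjugatesOf_self, fun h => absurd h hn⟩
  choose x hx1 hx2 using H
  refine ⟨(x : SymRed k),
    map_mem_conjugatesOf_pow (QuotientGroup.mk' _) (pi_mem_conjugatesOf_pow hx1), ?_⟩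
  rw [symDist_eq_zero_iff]
  refine squeeze_zero' (Eventually.of_forall fun n => hamming_nonneg _ _) ?_
    ((tendsto_const_div hk (4 * j : ℕ)).mono_left inf_le_left)
  filter_upwards [h] with n hn
  rw [hamming]
  gcongr
  exact hx2 n hn

/-- An involution of length close to `1 / q`, from below. -/
theorem exists_involution_card_support (k : ℕ → ℕ) {q : ℕ} (hq : 0 < q) :
    ∃ s : ∀ n, Equiv.Perm (Fin (k n)), (∀ n, s n * s n = 1) ∧
      (∀ n, q * (s n).support.card ≤ k n) ∧ ∀ n, k n ≤ q * ((s n).support.card + 2) := by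
  choose s h1 h2 _ using fun n => exists_involution_disjoint (∅ : Finset (Fin (k n)))
    (k n / (2 * q)) (by
      rw [Finset.card_empty, Fintype.card_fin, zero_add]
      refine (Nat.mul_le_mul_left 2 (Nat.div_le_div_left (c := 2) (by omega) (by norm_num))).trans ?_
      omega)
  refine ⟨s, h1, fun n => ?_, fun n => ?_⟩
  · rw [h2, ← mul_assoc, mul_comm q]
    exact Nat.mul_div_le (k n) (2 * q)
  · have := Nat.lt_mul_div_succ (k n) (by omega : 0 < 2 * q)
    rw [h2]
    nlinarith

theorem symDist_one_le_of_symDist_eq_zero {S : PFin} {x y : SymRed k} (h : symDist S x y = 0) :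
    symDist S y 1 ≤ symDist S x 1 := by
  have h1 := symDist_mul_one_le S x (y⁻¹ * x)⁻¹
  rw [symDist_inv_one, ← symDist_eq_symDist_one, h] at h1
  simpa using h1

/-- The image of an involution `s` of length at most `1 / (q + 1)`, for `q = 2 j`, has length at most
`1 / q`. Otherwise every involution would be a product of `q` conjugates of `φ s` along some infinite
set; pulling this back, an involution of length `1` would be a product of `q` conjugates of `s`. -/
theorem symDist_map_small_involution_le (hk : Tendsto k atTop atTop) (hl : Tendsto l atTop atTop)
    {φ : SymRed k ≃* SymRed l} {θ : PFin ≃o PFin} (hθ : Induces φ θ) {S : PFin} (hS : S ≠ ⊥)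
    {j : ℕ} (hj : 2 ≤ j) {s : ∀ n, Equiv.Perm (Fin (k n))} (hs : ∀ n, s n * s n = 1)
    (hsc : ∀ n, (2 * j + 1) * (s n).support.card ≤ k n) :
    symDist (θ S) (φ s) 1 ≤ 1 / (2 * j : ℕ) := by
  have hj0 : (0 : ℝ) < (2 * j : ℕ) := by exact_mod_cast (by omega : 0 < 2 * j)
  by_contra! hcon
  obtain ⟨s', hs', hφs⟩ := exists_involution_lift (x := φ s)
    (by rw [← map_mul, mk_mul_self hs, map_one])
  obtain ⟨e, he, he', -⟩ := exists_full_involution k Set.univ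
  obtain ⟨e', hee', hφe⟩ := exists_involution_lift (x := φ e)
    (by rw [← map_mul, mk_mul_self he, map_one])
  obtain ⟨R, hR⟩ := exists_setClass (θ S)
  rw [hR, ← hφs, ← QuotientGroup.mk_one] at hcon
  obtain ⟨T, -, hT, hTs⟩ := exists_infinite_subset_of_lt_symDist (setClass_ne_bot_iff.1
    (by rw [← hR]; exact fun h => hS ((map_eq_bot_iff θ).1 h))) hcon
  obtain ⟨x, hx, hxe⟩ := exists_mem_conjugatesOf_pow_symDist_eq_zero hl hs' hee' hj (S := T) (by
    filter_upwards [mem_inf_of_right (mem_principal_self T)] with n hn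
    have h1 := hTs n hn
    have h0 : (0 : ℝ) < l n := by
      by_contra! h0
      have h0' : (l n : ℝ) = 0 := le_antisymm h0 (Nat.cast_nonneg _)
      rw [Pi.one_apply, hamming_one, h0', div_zero] at h1
      exact absurd h1 (not_lt.2 (by positivity))
    rw [Pi.one_apply, hamming_one, div_lt_div_iff₀ hj0 h0, one_mul] at h1
    have h2 := Finset.card_le_univ (e' n).support
    rw [Fintype.card_fin] at h2
    have h3 : l n < (s' n).support.card * (2 * j) := by exact_mod_cast h1
    linarith)
  rw [hφs] at hx
  rw [hφe, ← θ.apply_symm_apply (setClass T), ← φ.apply_symm_apply x] at hxe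
  have hne : θ.symm (setClass T) ≠ ⊥ := fun h =>
    setClass_ne_bot_iff.2 hT ((map_eq_bot_iff θ.symm).1 h)
  rw [← hθ _ hne] at hxe
  have hx' := map_mem_conjugatesOf_pow φ.symm.toMonoidHom hx
  have h1 := symDist_le_of_mem_conjugatesOf_pow (θ.symm (setClass T)) hx'
  have h2 := symDist_one_le_of_symDist_eq_zero hxe
  obtain ⟨R', hR'⟩ := exists_setClass (θ.symm (setClass T))
  have hR'i : R'.Infinite := setClass_ne_bot_iff.1 (hR' ▸ hne)
  have h3 : symDist (setClass R') (s : SymRed k) 1 ≤ 1 / ((2 * j : ℕ) + 1 : ℝ) := by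
    rw [← QuotientGroup.mk_one]
    refine symDist_le_of_eventually hR'i (Eventually.of_forall fun n => ?_)
    rw [Pi.one_apply, hamming_one]
    rcases Nat.eq_zero_or_pos (k n) with h0 | h0
    · rw [show (k n : ℝ) = 0 by exact_mod_cast h0, div_zero]
      positivity
    · rw [div_le_div_iff₀ (by exact_mod_cast h0) (by positivity), one_mul, mul_comm]
      exact_mod_cast hsc n
  obtain ⟨c, hc1, hc2⟩ := exists_between
    (show ((2 * j : ℕ) : ℝ) * (1 / ((2 * j : ℕ) + 1 : ℝ)) < 1 by
      rw [mul_one_div, div_lt_one (by positivity)]; linarith)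
  have h4 : c ≤ symDist (setClass R') (e : SymRed k) 1 := by
    rw [← QuotientGroup.mk_one]
    refine le_symDist_of_eventually hR'i ?_
    exact (eventually_le_full_involution hk he' hc2).filter_mono
      (inf_le_inf_left _ (principal_mono.2 (Set.subset_univ _)))
  rw [hR'] at h1 h2
  have h5 : φ.symm.toMonoidHom (φ s) = (s : SymRed k) := φ.symm_apply_apply _
  have h6 : φ.symm.toMonoidHom x = φ.symm x := rfl
  rw [h5, h6] at h1
  have h7 := mul_le_mul_of_nonneg_left h3 hj0.le
  linarith

/-- With `s` of length about `1 / (q + 1)`, an involution of length `r` is a product of about `r q`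
conjugates of `s`, so its image has length at most about `r`; the error vanishes as `q` tends to
infinity. -/
theorem symDist_map_involution_le (hk : Tendsto k atTop atTop) (hl : Tendsto l atTop atTop)
    {φ : SymRed k ≃* SymRed l} {θ : PFin ≃o PFin} (hθ : Induces φ θ) {S : PFin} (hS : S ≠ ⊥)
    {x : SymRed k} (hx : x * x = 1) :
    symDist (θ S) (φ x) 1 ≤ symDist S x 1 := by
  obtain ⟨p, hp, rfl⟩ := exists_involution_lift hx
  set r := symDist S (p : SymRed k) 1 with hr
  have hr0 : 0 ≤ r := symDist_nonneg _ _ _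
  obtain ⟨R, rfl⟩ := exists_setClass S
  have hR := setClass_ne_bot_iff.1 hS
  have hmain : ∀ j : ℕ, 2 ≤ j →
      symDist (θ (setClass R)) (φ p) 1 ≤ r + (r + 6) * (1 / (2 * j : ℕ)) := by
    intro j hj
    have hj0 : (0 : ℝ) < (2 * j : ℕ) := by exact_mod_cast (by omega : 0 < 2 * j)
    obtain ⟨s, hs, hs1, hs2⟩ := exists_involution_card_support k (Nat.succ_pos (2 * j))
    set q : ℝ := ((2 * j : ℕ) : ℝ) with hq
    -- The number `2 i` of conjugates exceeds `r (q + 1)` by at least `4`: this gives `2 i ≥ 4` and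
    -- absorbs both the rounding in the size of `s` and the fluctuation of the length of `p`.
    set i : ℕ := ⌊r * (q + 1) / 2⌋₊ + 3 with hi
    have hfl1 : (⌊r * (q + 1) / 2⌋₊ : ℝ) ≤ r * (q + 1) / 2 := Nat.floor_le (by positivity)
    have hfl2 := Nat.lt_floor_add_one (r * (q + 1) / 2)
    have hi1 : r * (q + 1) + 4 ≤ 2 * (i : ℝ) := by rw [hi]; push_cast; linarith
    have hi2 : 2 * (i : ℝ) ≤ r * (q + 1) + 6 := by rw [hi]; push_cast; linarith
    have hev : ∀ᶠ n in tails R, (p n).support.card ≤ 2 * i * (s n).support.card := by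
      have h1 := (symDist_le_iff hR).1 (le_refl (symDist (setClass R) (p : SymRed k)
        ((1 : ∀ n, Equiv.Perm (Fin (k n))) : SymRed k))) (r + 1 / (q + 1))
        (lt_add_of_pos_right _ (by positivity))
      have h2 : ∀ᶠ n in tails R, 4 * i * (q + 1) < (k n : ℝ) := by
        refine Filter.Eventually.filter_mono (inf_le_left : tails R ≤ cofinite) ?_
        rw [Nat.cofinite_eq_atTop]
        exact (tendsto_natCast_atTop_atTop.comp hk).eventually_gt_atTop _
      filter_upwards [h1, h2] with n h3 h4
      have h0 : (0 : ℝ) < k n := lt_of_le_of_lt (by positivity) h4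
      have h5 : (k n : ℝ) ≤ (q + 1) * ((s n).support.card + 2) := by
        rw [hq]; exact_mod_cast hs2 n
      rw [Pi.one_apply, hamming_one, div_lt_iff₀ h0] at h3
      have hq1 : 0 < q + 1 := by positivity
      have h6 : ((p n).support.card : ℝ) * (q + 1) < (r * (q + 1) + 1) * k n := by
        have := mul_lt_mul_of_pos_right h3 hq1
        calc _ < _ := this
          _ = _ := by field_simp
      have h7 : ((p n).support.card : ℝ) * (q + 1) ≤ 2 * i * (s n).support.card * (q + 1) := by
        have h8 := mul_le_mul_of_nonneg_left h5 (by positivity : (0 : ℝ) ≤ 2 * i)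
        have h9 := mul_le_mul_of_nonneg_right hi1 h0.le
        nlinarith
      have h8 := le_of_mul_le_mul_right h7 hq1
      exact_mod_cast h8
    obtain ⟨y, hy, hyp⟩ := exists_mem_conjugatesOf_pow_symDist_eq_zero hk hs hp
      (by omega : 2 ≤ i) hev
    have h1 := symDist_le_of_mem_conjugatesOf_pow (θ (setClass R))
      (map_mem_conjugatesOf_pow φ.toMonoidHom hy)
    have h2 := symDist_one_le_of_symDist_eq_zero ((hθ _ hS _ _).1 hyp)
    have h3 := symDist_map_small_involution_le hk hl hθ hS hj hs hs1
    have h4 : symDist (θ (setClass R)) (φ y) 1 ≤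
      (2 * i : ℕ) * symDist (θ (setClass R)) (φ s) 1 := h1
    calc symDist (θ (setClass R)) (φ p) 1 ≤ (2 * i : ℕ) * symDist (θ (setClass R)) (φ s) 1 :=
          h2.trans h4
      _ ≤ (r * (q + 1) + 6) * (1 / q) := by
          push_cast
          exact mul_le_mul hi2 h3 (symDist_nonneg _ _ _) (by positivity)
      _ = r + (r + 6) * (1 / q) := by field_simp; ring
  have hlim : Tendsto (fun j : ℕ => r + (r + 6) * (1 / ((2 * j : ℕ) : ℝ))) atTop (𝓝 r) := by
    have h1 : Tendsto (fun j : ℕ => 1 / ((2 * j : ℕ) : ℝ)) atTop (𝓝 0) :=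
      tendsto_const_nhds.div_atTop (tendsto_natCast_atTop_atTop.comp
        (tendsto_id.const_mul_atTop' (by norm_num : 0 < 2)))
    simpa using (h1.const_mul (r + 6)).const_add r
  exact ge_of_tendsto hlim ((eventually_ge_atTop 2).mono hmain)

theorem symDist_map_involution (hk : Tendsto k atTop atTop) (hl : Tendsto l atTop atTop)
    {φ : SymRed k ≃* SymRed l} {θ : PFin ≃o PFin} (hθ : Induces φ θ) {S : PFin} (hS : S ≠ ⊥)
    {x : SymRed k} (hx : x * x = 1) :
    symDist (θ S) (φ x) 1 = symDist S x 1 := by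
  refine le_antisymm (symDist_map_involution_le hk hl hθ hS hx) ?_
  have := symDist_map_involution_le hl hk hθ.symm (S := θ S)
    (fun h => hS ((map_eq_bot_iff θ).1 h)) (x := φ x) (by rw [← map_mul, hx, map_one])
  rwa [θ.symm_apply_apply, φ.symm_apply_apply] at this

end Conjugates

/-! ### Lengths of arbitrary elements -/

section Isometry

variable {k l : ℕ → ℕ}

theorem symDist_one_le_of_hamming_le {a b : ∀ n, Equiv.Perm (Fin (k n))} {u : ℕ → ℝ}
    (hu : Tendsto u cofinite (𝓝 0)) (h : ∀ n, hamming (a n) 1 ≤ hamming (b n) 1 + u n)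
    {S : PFin} (hS : S ≠ ⊥) : symDist S (a : SymRed k) 1 ≤ symDist S (b : SymRed k) 1 := by
  obtain ⟨S, rfl⟩ := exists_setClass S
  rw [setClass_ne_bot_iff] at hS
  rw [← QuotientGroup.mk_one]
  refine (symDist_le_iff hS).2 fun d hd => ?_
  obtain ⟨c, hc1, hc2⟩ := exists_between hd
  filter_upwards [(symDist_le_iff hS).1 le_rfl c hc1,
    (hu.mono_left (inf_le_left : tails S ≤ cofinite)).eventually
      (gt_mem_nhds (by linarith : 0 < d - c))] with n h1 h2
  have := h n
  simp only [Pi.one_apply] at *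
  linarith

/-- The lengths of `x` and `y` add up along every set: if they are at least `u` and `v` on all infinite
subsets of `T`, that is, if their limits inferior along `T` are at least `u` and `v`, then the product
has length at least `u + v` along `T`. Only the pseudometrics enter, so that the relation can be
transported by maps preserving them. -/
def LengthAdditive (x y : SymRed k) : Prop :=
  ∀ T : PFin, T ≠ ⊥ → ∀ u v : ℝ, (∀ R ≤ T, R ≠ ⊥ → u ≤ symDist R x 1) →
    (∀ R ≤ T, R ≠ ⊥ → v ≤ symDist R y 1) → u + v ≤ symDist T (x * y) 1

theorem eventually_lt_hamming {T : Set ℕ} {a : ∀ n, Equiv.Perm (Fin (k n))} {u c : ℝ}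
    (h : ∀ R ≤ setClass T, R ≠ ⊥ → u ≤ symDist R (a : SymRed k) 1) (hc : c < u) :
    ∀ᶠ n in tails T, c < hamming (a n) 1 := by
  by_contra hcon
  rw [not_eventually, frequently_inf_principal, frequently_cofinite_iff_infinite] at hcon
  have h1 := h _ (setClass_mono fun n hn => hn.1) (setClass_ne_bot_iff.2 hcon)
  rw [← QuotientGroup.mk_one] at h1
  have h2 := h1.trans (symDist_le_of_eventually hcon (c := c) (by
    filter_upwards [mem_inf_of_right (mem_principal_self _)] with n hn
    exact not_lt.1 hn.2))
  linarith

theorem lengthAdditive_of_disjoint {a b : ∀ n, Equiv.Perm (Fin (k n))}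
    (h : ∀ n, (a n).Disjoint (b n)) : LengthAdditive (a : SymRed k) (b : SymRed k) := by
  intro T hT u v hu hv
  obtain ⟨T, rfl⟩ := exists_setClass T
  rw [setClass_ne_bot_iff] at hT
  refine le_of_forall_lt fun c hc => ?_
  obtain ⟨d, hcd, hd⟩ := exists_between hc
  refine hcd.trans_le ?_
  rw [← QuotientGroup.mk_mul, ← QuotientGroup.mk_one]
  refine le_symDist_of_eventually hT ?_
  filter_upwards [eventually_lt_hamming hu (by linarith : u - (u + v - d) / 2 < u),
    eventually_lt_hamming hv (by linarith : v - (u + v - d) / 2 < v)] with n h1 h2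
  have h3 : hamming (a n * b n) 1 = hamming (a n) 1 + hamming (b n) 1 := by
    rw [hamming_one, (h n).card_support_mul, Nat.cast_add, add_div, ← hamming_one, ← hamming_one]
  rw [Pi.mul_apply, Pi.one_apply, h3]
  linarith

theorem card_support_mul_add_card_inter_le {α : Type*} [DecidableEq α] [Fintype α]
    (σ τ : Equiv.Perm α) :
    (σ * τ).support.card + (σ.support ∩ τ.support).card ≤ σ.support.card + τ.support.card := by
  rw [← Finset.card_union_add_card_inter σ.support]
  exact Nat.add_le_add_right (Finset.card_le_card (Equiv.Perm.support_mul_le σ τ)) _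

/-- Every infinite set contains an infinite set on which the length varies by at most `d`. -/
theorem exists_infinite_subset_hamming_near {S : Set ℕ} (hS : S.Infinite)
    (a : ∀ n, Equiv.Perm (Fin (k n))) {d : ℝ} (hd : 0 < d) :
    ∃ T ⊆ S, T.Infinite ∧ ∃ u : ℝ, ∀ n ∈ T, u ≤ hamming (a n) 1 ∧ hamming (a n) 1 ≤ u + d := by
  set r := symDist (setClass S) (a : SymRed k) ((1 : ∀ n, Equiv.Perm (Fin (k n))) : SymRed k)
    with hr
  obtain ⟨T, hTS, hT, hTa⟩ := exists_infinite_subset_of_lt_symDist hS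
    (show r - d / 2 < r by linarith)
  have h := eventually_inf_principal.1 ((symDist_le_iff hS).1 (le_refl r) (r + d / 2) (by linarith))
  refine ⟨T ∩ {n | n ∈ S → hamming (a n) 1 < r + d / 2}, Set.inter_subset_left.trans hTS, ?_,
    r - d / 2, fun n hn => ⟨(hTa n hn.1).le, by linarith [hn.2 (hTS hn.1)]⟩⟩
  exact frequently_cofinite_iff_infinite.1
    ((frequently_cofinite_iff_infinite (p := (· ∈ T)).2 hT).and_eventually h)

/-- Length-additive elements have almost disjoint supports: an overlap of at least `d` on an infinite
set makes the product shorter than the sum of the lengths by `d`, while both lengths can be made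
nearly constant on an infinite subset. -/
theorem LengthAdditive.tendsto {a b : ∀ n, Equiv.Perm (Fin (k n))}
    (h : LengthAdditive (a : SymRed k) (b : SymRed k)) :
    Tendsto (fun n => (((a n).support ∩ (b n).support).card : ℝ) / k n) cofinite (𝓝 0) := by
  rw [tendsto_order]
  refine ⟨fun d hd => Eventually.of_forall fun n => hd.trans_le (by positivity), fun d hd => ?_⟩
  by_contra hcon
  rw [not_eventually, frequently_cofinite_iff_infinite] at hcon
  obtain ⟨T₁, h1, hT₁, u, hu⟩ := exists_infinite_subset_hamming_near hcon a
    (by positivity : 0 < d / 3)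
  obtain ⟨T, h2, hT, v, hv⟩ := exists_infinite_subset_hamming_near hT₁ b
    (by positivity : 0 < d / 3)
  have hle : ∀ (c : ∀ n, Equiv.Perm (Fin (k n))) (w : ℝ), (∀ n ∈ T, w ≤ hamming (c n) 1) →
      ∀ R ≤ setClass T, R ≠ ⊥ → w ≤ symDist R (c : SymRed k) 1 := by
    intro c w hw R hR hR'
    obtain ⟨R, rfl⟩ := exists_setClass R
    rw [← QuotientGroup.mk_one]
    refine le_symDist_of_eventually (setClass_ne_bot_iff.1 hR') ?_
    exact eventually_inf_principal.2 ((setClass_le_iff.1 hR).mono fun n hn hnR => hw n (hn hnR))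
  have h3 := h (setClass T) (setClass_ne_bot_iff.2 hT) u v
    (hle a u fun n hn => (hu n (h2 hn)).1) (hle b v fun n hn => (hv n hn).1)
  rw [← QuotientGroup.mk_mul, ← QuotientGroup.mk_one] at h3
  have h4 := h3.trans (symDist_le_of_eventually hT (c := u + d / 3 + (v + d / 3) - d) (by
    filter_upwards [mem_inf_of_right (mem_principal_self T)] with n hn
    have h5 : d ≤ _ := not_lt.1 (h1 (h2 hn))
    have h6 := (hu n (h2 hn)).2
    have h7 := (hv n hn).2
    have h8 : hamming (a n * b n) 1 + (((a n).support ∩ (b n).support).card : ℝ) / k n ≤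
        hamming (a n) 1 + hamming (b n) 1 := by
      rw [hamming_one, hamming_one, hamming_one, ← add_div, ← add_div]
      refine div_le_div_of_nonneg_right ?_ (Nat.cast_nonneg _)
      exact_mod_cast card_support_mul_add_card_inter_le (a n) (b n)
    rw [Pi.mul_apply, Pi.one_apply]
    linarith))
  linarith

/-- Commuting involutions have a product which is an involution, and lengths of involutions are known
to be preserved. -/
theorem LengthAdditive.map (hk : Tendsto k atTop atTop) (hl : Tendsto l atTop atTop)
    {φ : SymRed k ≃* SymRed l} {θ : PFin ≃o PFin} (hθ : Induces φ θ) {x y : SymRed k}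
    (hx : x * x = 1) (hy : y * y = 1) (hxy : Commute x y) (h : LengthAdditive x y) :
    LengthAdditive (φ x) (φ y) := by
  have hmap : ∀ {R : PFin}, R ≠ ⊥ → ∀ {z : SymRed k}, z * z = 1 →
      symDist (θ R) (φ z) 1 = symDist R z 1 := fun hR _ hz => symDist_map_involution hk hl hθ hR hz
  intro T hT u v hu hv
  obtain ⟨T, rfl⟩ := θ.surjective T
  have hT' : T ≠ ⊥ := fun h => hT ((map_eq_bot_iff θ).2 h)
  rw [← map_mul, hmap hT' (mul_self_mul_of_commute hxy hx hy)]
  refine h T hT' u v (fun R hR hR' => ?_) (fun R hR hR' => ?_)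
  · rw [← hmap hR' hx]
    exact hu _ (θ.monotone hR) fun h => hR' ((map_eq_bot_iff θ).1 h)
  · rw [← hmap hR' hy]
    exact hv _ (θ.monotone hR) fun h => hR' ((map_eq_bot_iff θ).1 h)

theorem commute_of_tendsto {a b : ∀ n, Equiv.Perm (Fin (k n))}
    (h : Tendsto (fun n => (((a n).support ∩ (b n).support).card : ℝ) / k n) cofinite (𝓝 0)) :
    Commute (a : SymRed k) (b : SymRed k) := by
  change (a : SymRed k) * (b : SymRed k) = (b : SymRed k) * (a : SymRed k)
  rw [← QuotientGroup.mk_mul, ← QuotientGroup.mk_mul, mk_eq_mk_iff]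
  have h2 := h.const_mul 3
  rw [mul_zero] at h2
  refine squeeze_zero (fun n => hamming_nonneg _ _) (fun n => ?_) h2
  rw [hamming, ← mul_div_assoc]
  gcongr
  exact_mod_cast hammingDist_mul_comm_le (a n) (b n)

/-- If `x` commutes with all involutions supported off the support of `r`, then `x` is almost supported
on the support of `r`. Otherwise a large set of points moved by `x` off the support of `r` contains
a large subset disjoint from its image, and an involution of this subset does not commute with `x`. -/
theorem symDist_le_of_forall_commute (hk : Tendsto k atTop atTop) {x r : SymRed k}
    (h : ∀ t : SymRed k, t * t = 1 → Commute t r → LengthAdditive t r → Commute x t) {S : PFin}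
    (hS : S ≠ ⊥) : symDist S x 1 ≤ symDist S r 1 := by
  induction x using QuotientGroup.induction_on with | _ a =>
  induction r using QuotientGroup.induction_on with | _ b =>
  have H : ∀ n, ∃ t : Equiv.Perm (Fin (k n)), t * t = 1 ∧ t.Disjoint (b n) ∧
      (a n).support.card ≤ (b n).support.card +
        (3 * hammingDist ⇑(a n * t) ⇑(t * a n) + 3) := by
    intro n
    obtain ⟨B, hB, hBc, hBa⟩ := exists_subset_disjoint_image (a n)
      ((a n).support \ (b n).support) fun x hx =>
        Equiv.Perm.mem_support.1 (Finset.mem_sdiff.1 hx).1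
    obtain ⟨t, ht, htB, htc⟩ := exists_involution_support_subset B
    refine ⟨t, ht, ?_, ?_⟩
    · rw [Equiv.Perm.disjoint_iff_disjoint_support]
      exact Finset.disjoint_of_subset_left (htB.trans hB) Finset.sdiff_disjoint
    · have h1 := card_support_le_hammingDist_mul_comm (a := a n) (c := t) fun x hx hax =>
        hBa x (htB hx) (htB hax)
      have h2 := Finset.le_card_sdiff (b n).support (a n).support
      omega
  choose t ht htb hta using H
  have h1 : Commute (a : SymRed k) (t : SymRed k) := by
    refine h _ (mk_mul_self ht) ?_ (lengthAdditive_of_disjoint htb)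
    exact congrArg (QuotientGroup.mk (s := nullSubgroup k)) (funext fun n => (htb n).commute.eq)
  have h2 : (a : SymRed k) * (t : SymRed k) = (t : SymRed k) * (a : SymRed k) := h1
  rw [← QuotientGroup.mk_mul, ← QuotientGroup.mk_mul, mk_eq_mk_iff] at h2
  have h3 := (h2.const_mul 3).add (tendsto_const_div hk 3)
  rw [mul_zero, zero_add] at h3
  refine symDist_one_le_of_hamming_le h3 (fun n => ?_) hS
  rw [hamming_one, hamming_one, hamming, ← mul_div_assoc, ← add_div, ← add_div]
  gcongr
  exact_mod_cast hta n

/-- The involution `r` moves all but at most one of the points moved by `x`. -/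
theorem exists_involution_forall_commute (hk : Tendsto k atTop atTop) (x : SymRed k) :
    ∃ r : SymRed k, r * r = 1 ∧ (∀ S ≠ ⊥, symDist S r 1 ≤ symDist S x 1) ∧
      ∀ t : SymRed k, LengthAdditive t r → Commute x t := by
  induction x using QuotientGroup.induction_on with | _ a =>
  choose r hr hra hrc using fun n => exists_involution_support_subset (a n).support
  refine ⟨r, mk_mul_self hr, fun S hS => ?_, fun t ht => ?_⟩
  · refine symDist_one_le_of_hamming_le (u := fun _ => 0) tendsto_const_nhds (fun n => ?_) hS
    rw [add_zero, hamming_one, hamming_one]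
    gcongr
    exact hra n
  · induction t using QuotientGroup.induction_on with | _ t =>
    have h0 := ht.tendsto.add (tendsto_const_div hk 1)
    rw [add_zero] at h0
    refine commute_of_tendsto (squeeze_zero (fun n => by positivity) (fun n => ?_) h0)
    rw [← add_div]
    refine div_le_div_of_nonneg_right ?_ (Nat.cast_nonneg _)
    have h1 : ((a n).support ∩ (t n).support).card ≤
        ((t n).support ∩ (r n).support).card + ((a n).support \ (r n).support).card := by
      refine (Finset.card_le_card fun x hx => ?_).trans (Finset.card_union_le _ _)
      simp only [Finset.mem_union, Finset.mem_inter, Finset.mem_sdiff] at hx ⊢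
      tauto
    have h2 := Finset.card_sdiff_of_subset (hra n)
    have h3 := hrc n
    have h4 : ((a n).support ∩ (t n).support).card ≤
      ((t n).support ∩ (r n).support).card + 1 := by omega
    exact_mod_cast h4

theorem symDist_map_le (hk : Tendsto k atTop atTop) (hl : Tendsto l atTop atTop)
    {φ : SymRed k ≃* SymRed l} {θ : PFin ≃o PFin} (hθ : Induces φ θ) {S : PFin} (hS : S ≠ ⊥)
    (x : SymRed k) : symDist (θ S) (φ x) 1 ≤ symDist S x 1 := by
  obtain ⟨r, hr, hrx, hrt⟩ := exists_involution_forall_commute hk x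
  refine le_trans ?_ ((symDist_map_involution hk hl hθ hS hr).trans_le (hrx S hS))
  refine symDist_le_of_forall_commute hl (fun t ht htr hadd => ?_)
    fun h => hS ((map_eq_bot_iff θ).1 h)
  have h1 := hadd.map hl hk hθ.symm ht (by rw [← map_mul, hr, map_one]) htr
  rw [φ.symm_apply_apply] at h1
  simpa using (hrt _ h1).map φ

theorem symDist_map (hk : Tendsto k atTop atTop) (hl : Tendsto l atTop atTop)
    {φ : SymRed k ≃* SymRed l} {θ : PFin ≃o PFin} (hθ : Induces φ θ) {S : PFin} (hS : S ≠ ⊥)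
    (x y : SymRed k) : symDist S x y = symDist (θ S) (φ x) (φ y) := by
  rw [symDist_eq_symDist_one S, symDist_eq_symDist_one (θ S), ← map_inv, ← map_mul]
  refine le_antisymm ?_ (symDist_map_le hk hl hθ hS _)
  have := symDist_map_le hl hk hθ.symm (S := θ S) (fun h => hS ((map_eq_bot_iff θ).1 h))
    (φ (y⁻¹ * x))
  rwa [θ.symm_apply_apply, φ.symm_apply_apply] at this

end Isometry

end SymReduced

theorem mainTheorem5 (k l : ℕ → ℕ) (hk : Filter.Tendsto k Filter.atTop Filter.atTop)
    (hl : Filter.Tendsto l Filter.atTop Filter.atTop)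
    (φ : SymReduced.SymRed k ≃* SymReduced.SymRed l) :
    (∀ a b : SymReduced.SymRed k,
      SymReduced.symMetric a b = SymReduced.symMetric (φ a) (φ b)) ∧
    (∃! θ : SymReduced.PFin ≃o SymReduced.PFin, SymReduced.Induces φ θ) ∧
    (∀ θ : SymReduced.PFin ≃o SymReduced.PFin, SymReduced.Induces φ θ →
      ∀ S : SymReduced.PFin, S ≠ ⊥ → ∀ a b : SymReduced.SymRed k,
        SymReduced.symDist S a b = SymReduced.symDist (θ S) (φ a) (φ b)) := by
  have hex := SymReduced.existsUnique_induces hk hl φ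
  refine ⟨fun a b => ?_, hex, fun θ hθ S hS a b => SymReduced.symDist_map hk hl hθ hS a b⟩
  obtain ⟨θ, hθ, -⟩ := hex
  have htop : (⊤ : SymReduced.PFin) ≠ ⊥ := by
    rw [SymReduced.top_eq_setClass, SymReduced.setClass_ne_bot_iff]
    exact Set.infinite_univ
  rw [SymReduced.symMetric_eq_symDist_top, SymReduced.symMetric_eq_symDist_top,
    SymReduced.symDist_map hk hl hθ htop, θ.map_top]
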